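/- **Notation.** Let $\tau^i=-\tfrac{i}{2}\sigma^i$ ($i=1,2,3$, $\sigma^i$ the Pauli matrices) and identify $v\in\mathbb R^3$ with $v^i\tau_i\in\mathfrak{su}(2)$; $X\triangleright v$ denotes the adjoint action of $X\in SU(2)$. $Spin(4)=SU(2)\times SU(2)$, $G=(X^-,X^+)$, acts on $\mathbb R^4$ by $\zeta(G\cdot V)=X^-\zeta(V)(X^+)^{-1}$ with $\zeta(V)=V^0I+i\sigma_jV^j$; let $\mathcal N=(1,0,0,0)$. Let $V_j$ be the spin-$j$ representation $\rho$ of $SU(2)$ on symmetric spinors of rank $2j$, with Hermitian inner product $\langle\cdot,\cdot\rangle$ (antilinear in the first slot), generators $\hat L^i=i\rho(\tau^i)$, invariant bilinear form $\epsilon$, and antilinear map $J$ given by $\epsilon(\psi,\phi)=\langle J\psi,\phi\rangle$. For a unit vector $n\in\mathbb R^3$ let $|n\rangle_{1/2}$ be a unit eigenvector of $n\cdot\hat L$ in $V_{1/2}$ with eigenvalue $\tfrac12$, its phase being chosen arbitrarily, and let $|n\rangle_j=|n\rangle_{1/2}^{\otimes 2j}\in V_j$. The same choice of $|m\rangle_{1/2}$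 is used in all factors below; the phases of the states $|n_{ab}\rangle$ may be chosen separately for each $(a,b)$. Let $\gamma>1$. *Boundary data* $\{k_{ab},n_{ab}\}$ consist, for $a\ne b$ in $\{0,\dots,4\}$, of spins $k_{ab}=k_{ba}>0$ such that $s^\pm_{ab}:=\tfrac12|1\pm\gamma|k_{ab}$ are half-integers (elements of $\tfrac12\mathbb Z_{\ge 0}$, as is $k_{ab}$), and of unit vectors $n_{ab}\in\mathbb R^3$, one for each ordered pair. For $G_a=(X_a^-,X_a^+)\in Spin(4)$, $a=0,\dots,4$, put $G_{ab}=(X^-_{ab},X^+_{ab})=G_a^{-1}G_b$ and, with $\{c,d,e\}=\{0,\dots,4\}\setminus\{a,b\}$ in any order and $\mathrm{sgn}(0)=0$, $$\beta_{ab}=-\mathrm{sgn}\big[\epsilon_{ijk}(G_{ac}\cdot\mathcal N)^i(G_{ad}\cdot\mathcal N)^j(G_{ae}\cdot\mathcal N)^k\;\epsilon_{lmn}(G_{bc}\cdot\mathcal N)^l(G_{bd}\cdot\mathcal N)^m(G_{be}\cdot\mathcal N)^n\big].$$ Let $P_{ba}$ be the orthogonal projector in $V_{k_{ab}}$ onto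 the span of the eigenspaces with positive eigenvalue of $\beta_{ab}\,\mathrm{tr}(\tau_iX^-_{ba}X^+_{ab})\hat L^i$. The proper action $S_{\gamma>1}$ is defined (modulo $2\pi i$, where the right side is nonzero), as a function of $\{G_a\}\in Spin(4)^5$ and of unit vectors $m_{ab}\in\mathbb R^3$ ($a\neq b$), by $$\exp(S_{\gamma>1})=\prod_{a<b}{}_{k_{ab}}\langle m_{ab}|n_{ab}\rangle_{k_{ab}}\;{}_{s^+_{ab}}\langle Jm_{ab}|\rho(X^+_{ab})|m_{ba}\rangle_{s^+_{ab}}\;{}_{k_{ab}}\langle m_{ba}|P_{ba}|n_{ba}\rangle_{k_{ab}}\;\overline{{}_{s^-_{ab}}\langle Jm_{ab}|\rho(X^-_{ab})|m_{ba}\rangle_{s^-_{ab}}}.$$ A *critical point* of $S_{\gamma>1}$ is a point $\{G_a,m_{ab}\}$ at which $\mathrm{Re}\,S_{\gamma>1}\ge 0$ (in particular $\exp(S_{\gamma>1})\neq0$) and at which $S_{\gamma>1}$ is stationary: its derivative along every variation of the $G_a$ and $m_{ab}$ exists and vanishes. **Theorem.** Let $\gamma>1$ and let boundary data $\{k_{ab},n_{ab}\}$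 be given. Then $\{G_a,m_{ab}\}$ is a critical point of $S_{\gamma>1}$ if and only if all of the following hold: 1. (closure) $\sum_{b\ne a}k_{ab}n_{ab}=0$ for every $a$; 2. (orientation) $X_a^\pm\triangleright n_{ab}=-X_b^\pm\triangleright n_{ba}$ for all $a\neq b$ and both signs; 3. (proper orientation) $\beta_{ab}\,\mathrm{tr}(\tau_iX^-_{ba}X^+_{ab})\,n_{ba}^i>0$ for all $a<b$; 4. $m_{ab}=n_{ab}$ for all $a\ne b$. -/

import Mathlib

open Filter Topology

noncomputable section

namespace ProperEPRL

/-! ### `SU(2)`, `su(2)` and `Spin(4)` -/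

/-- The group `SU(2)`. -/
abbrev SU2 : Type := Matrix.specialUnitaryGroup (Fin 2) ℂ

/-- `Spin(4) = SU(2) × SU(2)`; an element is `G = (X⁻, X⁺)`. -/
abbrev Spin4 : Type := SU2 × SU2

/-- Euclidean three-space. -/
abbrev R3 : Type := EuclideanSpace ℝ (Fin 3)

/-- Unit three-vectors. -/
abbrev UnitVec : Type := Metric.sphere (0 : R3) 1

/-- Spinors, that is, vectors of the spin-1/2 representation. -/
abbrev Spinor : Type := EuclideanSpace ℂ (Fin 2)

/-- The Pauli matrices. -/
def pauli : Fin 3 → Matrix (Fin 2) (Fin 2) ℂ :=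
  ![!![0, 1; 1, 0], !![0, -Complex.I; Complex.I, 0], !![1, 0; 0, -1]]

/-- The basis `τ^i = -(i/2) σ^i` of `su(2)`. -/
def tau (i : Fin 3) : Matrix (Fin 2) (Fin 2) ℂ := (-Complex.I / 2) • pauli i

/-- The element `v^i τ_i` of `su(2)` with components `v`. -/
def su2 (v : R3) : Matrix (Fin 2) (Fin 2) ℂ := ∑ i, (v i : ℂ) • tau i

/-- The adjoint action of `X ∈ SU(2)` on `v ∈ ℝ³ ≅ su(2)`, as an element of `su(2)`. -/
def adjoint (X : SU2) (v : R3) : Matrix (Fin 2) (Fin 2) ℂ :=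
  (X : Matrix (Fin 2) (Fin 2) ℂ) * su2 v * ((X⁻¹ : SU2) : Matrix (Fin 2) (Fin 2) ℂ)

/-- `ζ(V) = V⁰ I + i σ_j V^j` for `V ∈ ℝ⁴`. -/
def zeta (V : Fin 4 → ℝ) : Matrix (Fin 2) (Fin 2) ℂ :=
  (V 0 : ℂ) • (1 : Matrix (Fin 2) (Fin 2) ℂ) + Complex.I • ∑ j : Fin 3, (V j.succ : ℂ) • pauli j

/-- The coordinates `V` of a matrix of the form `ζ(V)`. -/
def zetaCoord (M : Matrix (Fin 2) (Fin 2) ℂ) : Fin 4 → ℝ :=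
  Fin.cons (M.trace.re / 2) (fun i : Fin 3 => ((tau i * M).trace).re)

/-- The action of `Spin(4)` on `ℝ⁴`, determined by `ζ(G · V) = X⁻ ζ(V) (X⁺)⁻¹`
(see `zeta_spin4Act`). -/
def spin4Act (G : Spin4) (V : Fin 4 → ℝ) : Fin 4 → ℝ :=
  zetaCoord ((G.1 : Matrix (Fin 2) (Fin 2) ℂ) * zeta V *
    ((G.2⁻¹ : SU2) : Matrix (Fin 2) (Fin 2) ℂ))

/-- The reference vector `𝒩 = (1, 0, 0, 0)`. -/
def refVec : Fin 4 → ℝ := ![1, 0, 0, 0]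

/-! ### The spin `N/2` representation of `SU(2)` on symmetric spinors of rank `N` -/

/-- The carrying space `V_j` for `j = N/2`: the symmetric spinors of rank `N`. -/
def SymSpinor (N : ℕ) : Submodule ℂ (EuclideanSpace ℂ (Fin N → Fin 2)) where
  carrier := {ψ | ∀ (σ : Equiv.Perm (Fin N)) (A : Fin N → Fin 2), ψ (A ∘ σ) = ψ A}
  add_mem' := by
    intro x y hx hy σ A
    simp [hx σ A, hy σ A]
  zero_mem' := by
    intro σ A
    simp
  smul_mem' := by
    intro c x hx σ A
    simp [hx σ A]

/-- Applying a two-index spinor tensor of product form to a symmetric spinor. -/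
theorem sum_prod_symm {N : ℕ} (g : Matrix (Fin 2) (Fin 2) ℂ) (f : (Fin N → Fin 2) → ℂ)
    (hf : ∀ (σ : Equiv.Perm (Fin N)) (A : Fin N → Fin 2), f (A ∘ σ) = f A)
    (σ : Equiv.Perm (Fin N)) (A : Fin N → Fin 2) :
    ∑ B : Fin N → Fin 2, (∏ r, g ((A ∘ σ) r) (B r)) * f B =
      ∑ B : Fin N → Fin 2, (∏ r, g (A r) (B r)) * f B := by
  refine (Fintype.sum_equiv (σ.arrowCongr (Equiv.refl (Fin 2))).symm _ _ ?_).symm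
  intro B
  have h1 : (σ.arrowCongr (Equiv.refl (Fin 2))).symm B = B ∘ σ := by
    ext r; simp
  rw [h1, hf σ B]
  congr 1
  exact (Equiv.prod_comp σ (fun r => g (A r) (B r))).symm

/-- The representation `ρ_j(g)`, `j = N/2`:
`(ρ(g)ψ)^{A₁⋯A_N} = g^{A₁}_{B₁} ⋯ g^{A_N}_{B_N} ψ^{B₁⋯B_N}`. -/
def rho (N : ℕ) (g : SU2) : SymSpinor N →ₗ[ℂ] SymSpinor N where
  toFun ψ := ⟨WithLp.toLp 2 fun A => ∑ B : Fin N → Fin 2,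
      (∏ r, (g : Matrix (Fin 2) (Fin 2) ℂ) (A r) (B r)) * ψ.1 B, by
    intro σ A
    exact sum_prod_symm _ (fun B => ψ.1 B) ψ.2 σ A⟩
  map_add' := by
    intro x y
    ext A
    simp [mul_add, Finset.sum_add_distrib]
  map_smul' := by
    intro c x
    ext A
    simp [Finset.mul_sum, mul_left_comm]

/-- The representation `ρ_j(x)` of a Lie algebra element (the derivative of the group
representation): the sum over `r` of `x` acting on the `r`-th spinor index. -/
def rhoLie (N : ℕ) (x : Matrix (Fin 2) (Fin 2) ℂ) : SymSpinor N →ₗ[ℂ] SymSpinor N where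
  toFun ψ := ⟨WithLp.toLp 2 fun A => ∑ r, ∑ c, x (A r) c * ψ.1 (Function.update A r c), by
    intro σ A
    have h : ∀ (r : Fin N) (c : Fin 2),
        ψ.1 (Function.update (A ∘ σ) r c) = ψ.1 (Function.update A (σ r) c) := by
      intro r c
      have h1 : Function.update (A ∘ σ) r c = Function.update A (σ r) c ∘ σ := by
        funext s
        by_cases hs : s = r
        · subst hs; simp
        · have hs' : σ s ≠ σ r := fun h => hs (σ.injective h)
          simp [Function.update_of_ne hs, Function.update_of_ne hs']
      rw [h1]
      exact ψ.2 σ _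
    change ∑ r, ∑ c, x (A (σ r)) c * ψ.1 (Function.update (A ∘ σ) r c) = _
    simp only [h]
    exact Equiv.sum_comp σ (fun r => ∑ c, x (A r) c * ψ.1 (Function.update A r c))⟩
  map_add' := by
    intro x y
    ext A
    simp [mul_add, Finset.sum_add_distrib]
  map_smul' := by
    intro c x
    ext A
    simp [Finset.mul_sum, mul_add, mul_left_comm]

/-- The self-adjoint generators `L^i = i ρ(τ^i)`. -/
def Lgen (N : ℕ) (i : Fin 3) : SymSpinor N →ₗ[ℂ] SymSpinor N :=
  Complex.I • rhoLie N (tau i)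

/-- The operator `v · L = v_i L^i`. -/
def dotL (N : ℕ) (v : Fin 3 → ℝ) : SymSpinor N →ₗ[ℂ] SymSpinor N :=
  ∑ i, (v i : ℂ) • Lgen N i

/-- The alternating spinor `ε_{AB}`. -/
def epsMat : Matrix (Fin 2) (Fin 2) ℂ := !![0, 1; -1, 0]

/-- The invariant bilinear form
`ε(ψ, φ) = ψ^{A₁⋯A_N} φ^{B₁⋯B_N} ε_{A₁B₁} ⋯ ε_{A_NB_N}` on `V_j`. -/
def epsForm (N : ℕ) (ψ φ : SymSpinor N) : ℂ :=
  ∑ A : Fin N → Fin 2, ∑ B : Fin N → Fin 2, (∏ r, epsMat (A r) (B r)) * ψ.1 A * φ.1 B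

/-- The antilinear structure map `J`, determined by `ε(ψ, φ) = ⟨Jψ, φ⟩` (see `epsForm_eq`). -/
def Jmap (N : ℕ) (ψ : SymSpinor N) : SymSpinor N :=
  ⟨WithLp.toLp 2 fun B => ∑ A : Fin N → Fin 2,
      (∏ r, epsMat.transpose (B r) (A r)) * (starRingEnd ℂ) (ψ.1 A), by
    intro σ B
    exact sum_prod_symm _ (fun A => (starRingEnd ℂ) (ψ.1 A))
      (fun τ A => congrArg (starRingEnd ℂ) (ψ.2 τ A)) σ B⟩

/-- The spectral projector `P_{(0,∞)}(O)` of a self-adjoint operator `O`: the orthogonal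
projection onto the span of the eigenspaces with positive eigenvalue. -/
def positiveSpectralProj {V : Type*} [NormedAddCommGroup V] [InnerProductSpace ℂ V]
    [FiniteDimensional ℂ V] (O : V →ₗ[ℂ] V) : V →L[ℂ] V :=
  (⨆ μ : {μ : ℝ // 0 < μ}, Module.End.eigenspace O ((μ : ℝ) : ℂ)).starProjection

/-- `z` is a spin-1/2 coherent state `|n⟩_{1/2}`: a unit vector which is an eigenvector of
`n · L = n_i σ^i / 2` with eigenvalue `1/2`. It is determined by `n` up to a phase. -/
def IsCoherentSpinor (n : UnitVec) (z : Spinor) : Prop :=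
  ‖z‖ = 1 ∧ ∀ A, ∑ B, (∑ i, ((n : R3) i : ℂ) • ((1 / 2 : ℂ) • pauli i)) A B * z B = (1 / 2 : ℂ) * z A

/-- The spin-`N/2` coherent state `z^{A₁} ⋯ z^{A_N}` built from the spin-1/2 coherent
state `z`. -/
def coherent (N : ℕ) (z : Spinor) : SymSpinor N :=
  ⟨WithLp.toLp 2 fun A => ∏ r, z (A r), by
    intro σ A
    exact Equiv.prod_comp σ (fun r => z (A r))⟩

/-! ### Boundary data and the conditions on it -/

/-- `K_γ`, with spins recorded as `N = 2k`: the spins `k` for which `s^± = |1 ± γ| k / 2` are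
half-integers, that is, `2 s^± = |1 ± γ| N / 2` are natural numbers. -/
def allowedSpins (γ : ℝ) : Set ℕ :=
  {N | (∃ p : ℕ, (p : ℝ) = |1 + γ| * N / 2) ∧ ∃ q : ℕ, (q : ℝ) = |1 - γ| * N / 2}

/-- `2 s⁺ = |1 + γ| k`, for `N = 2k` in `K_γ`. -/
def twoSPlus (γ : ℝ) (N : ℕ) : ℕ := ⌊|1 + γ| * N / 2⌋₊

/-- `2 s⁻ = |1 - γ| k`, for `N = 2k` in `K_γ`. -/
def twoSMinus (γ : ℝ) (N : ℕ) : ℕ := ⌊|1 - γ| * N / 2⌋₊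

/-- Quantum boundary data: a positive spin `k_ab = k_ba ∈ K_γ` (recorded as `twoK a b = 2 k_ab`)
for each triangle, and a unit vector `n_ab` for each ordered pair of distinct tetrahedra.
The diagonal values are not used. -/
structure BoundaryData (γ : ℝ) where
  twoK : Fin 5 → Fin 5 → ℕ
  symm : ∀ a b, twoK a b = twoK b a
  pos : ∀ a b, a ≠ b → 0 < twoK a b
  mem : ∀ a b, a ≠ b → twoK a b ∈ allowedSpins γ
  n : Fin 5 → Fin 5 → UnitVec

/-- `G_ab = (G_a)⁻¹ G_b = (X⁻_ab, X⁺_ab)`. -/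
def Grel (G : Fin 5 → Spin4) (a b : Fin 5) : Spin4 := (G a)⁻¹ * G b

/-- The three elements of `{0, …, 4} \ {a, b}`, for `a ≠ b`, in increasing order. -/
def others (a b : Fin 5) (r : Fin 3) : Fin 5 :=
  ((List.finRange 5).filter fun c => c ≠ a ∧ c ≠ b).getD r a

/-- `ε_{ijk} (G_ac · 𝒩)^i (G_ad · 𝒩)^j (G_ae · 𝒩)^k` for `{c, d, e} = {0, …, 4} \ {a, b}`. -/
def tripleProd (G : Fin 5 → Spin4) (a b : Fin 5) : ℝ :=
  Matrix.det (Matrix.of fun (r i : Fin 3) => spin4Act (Grel G a (others a b r)) refVec i.succ)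

/-- The sign `β_ab`. It does not depend on the order in which `c, d, e` are listed, the same
order being used in both triple products. -/
def beta (G : Fin 5 → Spin4) (a b : Fin 5) : ℝ :=
  -Real.sign (tripleProd G a b * tripleProd G b a)

/-- The (real) number `tr(τ^i X⁻_ab X⁺_ba)`. -/
def trAxis (G : Fin 5 → Spin4) (a b : Fin 5) (i : Fin 3) : ℝ :=
  (Matrix.trace (tau i * ((Grel G a b).1 : Matrix (Fin 2) (Fin 2) ℂ) *
    ((Grel G b a).2 : Matrix (Fin 2) (Fin 2) ℂ))).re

/-- Closure: `∑_{b ≠ a} k_ab n_ab = 0` for every `a`. -/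
def Closure {γ : ℝ} (D : BoundaryData γ) : Prop :=
  ∀ a, ∑ b ∈ Finset.univ.filter (fun b => b ≠ a), ((D.twoK a b : ℝ) / 2) • (D.n a b : R3) = 0

/-- Orientation: `X^±_a ▷ n_ab = - X^±_b ▷ n_ba` for all `a ≠ b`. -/
def Orientation {γ : ℝ} (D : BoundaryData γ) (G : Fin 5 → Spin4) : Prop :=
  ∀ a b, a ≠ b →
    adjoint (G a).1 (D.n a b) = -adjoint (G b).1 (D.n b a) ∧
    adjoint (G a).2 (D.n a b) = -adjoint (G b).2 (D.n b a)

/-- Proper orientation: `β_ab tr(τ_i X⁻_ba X⁺_ab) n_ba^i > 0` for all `a < b`. -/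
def ProperOrientation {γ : ℝ} (D : BoundaryData γ) (G : Fin 5 → Spin4) : Prop :=
  ∀ a b, a < b → 0 < beta G a b * ∑ i, trAxis G b a i * (D.n b a : R3) i

/-! ### The proper action for `γ > 1` and its critical points -/

/-- The projector `P_ba({G}) = P_{(0,∞)}(β_ab tr(τ_i X⁻_ba X⁺_ab) L^i)` on `V_{N/2}`. -/
def Pproj (N : ℕ) (G : Fin 5 → Spin4) (b a : Fin 5) : SymSpinor N →L[ℂ] SymSpinor N :=
  positiveSpectralProj (V := SymSpinor N) (dotL N fun i => beta G a b * trAxis G b a i)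

/-- The points `({G_a}, {m_ab})` on which the action is defined
(the diagonal values `m_aa` are dummies). -/
abbrev Config : Type := (Fin 5 → Spin4) × (Fin 5 → Fin 5 → UnitVec)

/-- The factor of `exp(S_{γ>1})` for the pair `(a, b)`:
`⟨m_ab|n_ab⟩_k ⟨J m_ab|ρ(X⁺_ab)|m_ba⟩_{s⁺} ⟨m_ba|P_ba|n_ba⟩_k conj ⟨J m_ab|ρ(X⁻_ab)|m_ba⟩_{s⁻}`.
Here `ν a b` is the spinor of the coherent state chosen for `n_ab`, and `w v` the spinor of the
coherent state chosen for the unit vector `v`. -/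
def faceFactor {γ : ℝ} (D : BoundaryData γ) (ν : Fin 5 → Fin 5 → Spinor) (w : UnitVec → Spinor)
    (x : Config) (a b : Fin 5) : ℂ :=
  let k := D.twoK a b
  let p := twoSPlus γ k
  let q := twoSMinus γ k
  inner ℂ (coherent k (w (x.2 a b))) (coherent k (ν a b)) *
  inner ℂ (Jmap p (coherent p (w (x.2 a b))))
    (rho p (Grel x.1 a b).2 (coherent p (w (x.2 b a)))) *
  inner ℂ (coherent k (w (x.2 b a))) (Pproj k x.1 b a (coherent k (ν b a))) *
  (starRingEnd ℂ) (inner ℂ (Jmap q (coherent q (w (x.2 a b))))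
    (rho q (Grel x.1 a b).1 (coherent q (w (x.2 b a)))))

/-- `exp(S_{γ>1})` as a function of `({G_a}, {m_ab})`: the product of the face factors over
`a < b`. -/
def expAction {γ : ℝ} (D : BoundaryData γ) (ν : Fin 5 → Fin 5 → Spinor) (w : UnitVec → Spinor)
    (x : Config) : ℂ :=
  ∏ a : Fin 5, ∏ b ∈ Finset.univ.filter (fun b => a < b), faceFactor D ν w x a b

/-- `c` is a variation of the configuration `x`: a curve of configurations through `x` at
parameter `0` with a velocity there. -/
structure IsVariation (x : Config) (c : ℝ → Config) : Prop where
  start : c 0 = x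
  diff_minus : ∀ a i j,
    DifferentiableAt ℝ (fun t => (((c t).1 a).1 : Matrix (Fin 2) (Fin 2) ℂ) i j) 0
  diff_plus : ∀ a i j,
    DifferentiableAt ℝ (fun t => (((c t).1 a).2 : Matrix (Fin 2) (Fin 2) ℂ) i j) 0
  diff_m : ∀ a b, DifferentiableAt ℝ (fun t => ((c t).2 a b : R3)) 0

/-- A critical point of the (possibly multivalued) action `S`, given through the function
`E = exp(S)`: the real part of `S` is nonnegative at `x` (in particular `E x ≠ 0`), and the
derivative of `S` along every variation of `x` exists and vanishes. -/
structure IsCriticalPoint (E : Config → ℂ) (x : Config) : Prop where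
  re_nonneg : ∃ S₀ : ℂ, Complex.exp S₀ = E x ∧ 0 ≤ S₀.re
  stationary : ∀ c : ℝ → Config, IsVariation x c →
    ∃ S : ℝ → ℂ, (∀ᶠ t in 𝓝 (0 : ℝ), Complex.exp (S t) = E (c t)) ∧ HasDerivAt S 0 0

/-! ### Consistency of the definitions -/

/-- The shape of the matrices of the form `ζ(V)`. -/
theorem zeta_zetaCoord (M : Matrix (Fin 2) (Fin 2) ℂ) (h1 : M 1 1 = (starRingEnd ℂ) (M 0 0))
    (h2 : M 1 0 = -(starRingEnd ℂ) (M 0 1)) : zeta (zetaCoord M) = M := by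
  ext i j
  fin_cases i <;> fin_cases j <;> apply Complex.ext <;>
    simp [zeta, zetaCoord, tau, pauli, Fin.sum_univ_three, Matrix.trace_fin_two,
      Matrix.mul_apply, Fin.sum_univ_two, h1, h2, Fin.cons] <;> ring

/-- The entries of an element of `SU(2)`. -/
theorem SU2_entries (X : SU2) :
    (X : Matrix (Fin 2) (Fin 2) ℂ) 1 1 = (starRingEnd ℂ) ((X : Matrix (Fin 2) (Fin 2) ℂ) 0 0) ∧
    (X : Matrix (Fin 2) (Fin 2) ℂ) 1 0 = -(starRingEnd ℂ) ((X : Matrix (Fin 2) (Fin 2) ℂ) 0 1) := by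
  obtain ⟨hu, hd⟩ := Matrix.mem_specialUnitaryGroup_iff.1 X.2
  have h1 : star (X : Matrix (Fin 2) (Fin 2) ℂ) * X = 1 := (Matrix.mem_unitaryGroup_iff'.1 hu)
  have h2 : (X : Matrix (Fin 2) (Fin 2) ℂ) * (X : Matrix (Fin 2) (Fin 2) ℂ).adjugate = 1 := by
    rw [Matrix.mul_adjugate, hd, one_smul]
  have h3 : star (X : Matrix (Fin 2) (Fin 2) ℂ) = (X : Matrix (Fin 2) (Fin 2) ℂ).adjugate :=
    left_inv_eq_right_inv h1 h2
  rw [Matrix.adjugate_fin_two] at h3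
  have e1 := congrFun (congrFun h3 0) 0
  have e2 := congrFun (congrFun h3 1) 0
  simp [Matrix.star_apply] at e1 e2
  refine ⟨e1.symm, ?_⟩
  rw [e2, neg_neg]

/-- The defining property of the action of `Spin(4)` on `ℝ⁴`. -/
theorem zeta_spin4Act (G : Spin4) (V : Fin 4 → ℝ) :
    zeta (spin4Act G V) = (G.1 : Matrix (Fin 2) (Fin 2) ℂ) * zeta V *
      ((G.2⁻¹ : SU2) : Matrix (Fin 2) (Fin 2) ℂ) := by
  obtain ⟨x1, x2⟩ := SU2_entries G.1
  obtain ⟨y1, y2⟩ := SU2_entries G.2⁻¹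
  refine zeta_zetaCoord _ ?_ ?_ <;>
    simp [Matrix.mul_apply, Fin.sum_univ_two, x1, x2, y1, y2, zeta, pauli, Fin.sum_univ_three] <;> ring

/-- The defining property of `J`. -/
theorem epsForm_eq (N : ℕ) (ψ φ : SymSpinor N) :
    epsForm N ψ φ = inner ℂ (Jmap N ψ) φ := by
  have he : ∀ i j, (starRingEnd ℂ) (epsMat i j) = epsMat i j := by
    intro i j
    fin_cases i <;> fin_cases j <;> simp [epsMat]
  rw [Submodule.coe_inner, PiLp.inner_apply, epsForm, Finset.sum_comm]
  refine Finset.sum_congr rfl fun B _ => ?_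
  simp [Jmap, he, map_prod, Finset.mul_sum, mul_comm, mul_left_comm]

/-- The tensor power of a spin-1/2 coherent state is a coherent state of spin `N/2`: it is a unit
vector and an eigenvector of `n · L` with the maximal eigenvalue `N/2`. -/
theorem coherent_spec (N : ℕ) (n : UnitVec) (z : Spinor) (hz : IsCoherentSpinor n z) :
    ‖coherent N z‖ = 1 ∧
      dotL N (fun i => (n : R3) i) (coherent N z) = ((N : ℂ) / 2) • coherent N z := by
  have hsq : ∑ c, ‖z c‖ ^ 2 = 1 := by
    rw [← EuclideanSpace.norm_sq_eq, hz.1, one_pow]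
  constructor
  · have h : ‖coherent N z‖ ^ 2 = 1 := by
      rw [Submodule.coe_norm, EuclideanSpace.norm_sq_eq]
      have h1 : ∀ A : Fin N → Fin 2, ‖(coherent N z).1 A‖ ^ 2 = ∏ r, ‖z (A r)‖ ^ 2 := by
        intro A
        simp [coherent, Finset.prod_pow]
      simp only [h1]
      have h2 := Finset.prod_univ_sum (fun _ : Fin N => (Finset.univ : Finset (Fin 2)))
        (fun _ c => ‖z c‖ ^ 2)
      simp only [hsq, Finset.prod_const_one, Fintype.piFinset_univ] at h2
      exact h2.symm
    have h0 := norm_nonneg (coherent N z)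
    nlinarith
  · ext A
    have key : ∀ r : Fin N, ∀ c : Fin 2,
        (coherent N z).1 (Function.update A r c) = z c * ∏ s ∈ Finset.univ.erase r, z (A s) := by
      intro r c
      change ∏ s, z (Function.update A r c s) = _
      rw [← Finset.mul_prod_erase _ _ (Finset.mem_univ r), Function.update_self]
      congr 1
      refine Finset.prod_congr rfl fun s hs => ?_
      rw [Function.update_of_ne (Finset.ne_of_mem_erase hs)]
    have hL : ∀ i, (Lgen N i (coherent N z)).1 A =
        Complex.I * ∑ r, ∑ c, tau i (A r) c *
          (z c * ∏ s ∈ Finset.univ.erase r, z (A s)) := by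
      intro i
      simp only [← key]
      rfl
    have hd : (dotL N (fun i => (n : R3) i) (coherent N z)).1 A =
        ∑ i, ((n : R3) i : ℂ) * (Lgen N i (coherent N z)).1 A := by
      simp [dotL, Fin.sum_univ_three]
    have hR : ((((N : ℂ) / 2) • coherent N z : SymSpinor N)).1 A =
        ∑ r : Fin N, (1 / 2 : ℂ) * z (A r) * ∏ s ∈ Finset.univ.erase r, z (A s) := by
      have h3 : ∀ r : Fin N, (1 / 2 : ℂ) * z (A r) * ∏ s ∈ Finset.univ.erase r, z (A s) =
          (1 / 2 : ℂ) * ∏ s, z (A s) := by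
        intro r
        rw [mul_assoc, Finset.mul_prod_erase _ (fun s => z (A s)) (Finset.mem_univ r)]
      simp only [h3]
      simp [coherent]
      ring
    rw [hd, hR]
    simp only [hL]
    simp only [Finset.mul_sum]
    rw [Finset.sum_comm]
    refine Finset.sum_congr rfl fun r _ => ?_
    rw [← hz.2 (A r)]
    simp only [Fin.sum_univ_three, Fin.sum_univ_two, Matrix.add_apply, Matrix.smul_apply, tau,
      smul_eq_mul]
    linear_combination (-(1 / 2 : ℂ) * (∏ s ∈ Finset.univ.erase r, z (A s)) *
      (((n : R3) 0 : ℂ) * (pauli 0 (A r) 0 * z 0 + pauli 0 (A r) 1 * z 1) +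
      ((n : R3) 1 : ℂ) * (pauli 1 (A r) 0 * z 0 + pauli 1 (A r) 1 * z 1) +
      ((n : R3) 2 : ℂ) * (pauli 2 (A r) 0 * z 0 + pauli 2 (A r) 1 * z 1))) * Complex.I_sq

end ProperEPRL

end

noncomputable section

namespace ProperEPRL

/-! Coherent states are tensor powers, so each factor of `exp(S)` except the one with the projector
is a power of a spin-1/2 quantity: an inner product of unit spinors, or `ε(X_a z, X_b z')`. Since
`|ε(u,v)|² + |⟨u,v⟩|² = ‖u‖²‖v‖²` and an orthogonal projector is a contraction, every factor has
modulus at most 1. Hence `Re S ≥ 0` forces every factor to have modulus 1, and the equality cases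
are geometric. `|⟨m|n⟩| = 1` means `m = n`, because `z z† = (1 + n·σ)/2` determines `n`. `|ε(X_a z,
X_b z')| = 1` means that the two rotated vectors are antipodal, which is orientation
(`norm_eps2_act_iff`). Orientation in both sectors makes `X⁻_ba X⁺_ab` commute with `n_ba`, so its
axis lies along `n_ba` (`trAxis_eq`). Then `|n_ba⟩` is an eigenvector of the operator defining
`P_ba`, and `P_ba` fixes it exactly when proper orientation holds, and kills it otherwise. So `Re S
≥ 0` is equivalent to conditions 2-4.

At such a point the logarithmic derivative can be computed. As `s⁺ = s⁻ + k`, the phases of the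
`|m⟩` cancel, and any choice of them may be replaced by a lift horizontal at the point
(`exists_horizontal_lift`); the `⟨m|n⟩` factors are then stationary. The projector factor is
stationary too: `⟨x,Py⟩ - ⟨x,y⟩ = -⟨(1-P)x,(1-P)y⟩` is a product of two first-order terms, so no
derivative of `P` is needed. Only the `ε` factors contribute, giving `-(i/2) ∑_a ⟨(1+γ)ξ⁺_a -
(γ-1)ξ⁻_a, ∑_b k_ab n_ab⟩` for velocities `ξ^±_a` in `su(2)` (`hasDerivAt_expAction`). This vanishes
for all velocities exactly when closure holds. -/

/-! ### Reduction of coherent states to spin 1/2 -/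

/-- The alternating form on spinors. -/
def eps2 (u v : Spinor) : ℂ := u 0 * v 1 - u 1 * v 0

/-- A matrix acting on a spinor. -/
def act (X : Matrix (Fin 2) (Fin 2) ℂ) (u : Spinor) : Spinor :=
  WithLp.toLp 2 fun A => X A 0 * u 0 + X A 1 * u 1

/-- The matrix `z z†`. -/
def outer (z : Spinor) : Matrix (Fin 2) (Fin 2) ℂ :=
  Matrix.of fun A B => z A * (starRingEnd ℂ) (z B)

theorem inner_spinor (u v : Spinor) :
    inner ℂ u v = v 0 * (starRingEnd ℂ) (u 0) + v 1 * (starRingEnd ℂ) (u 1) := by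
  simp [PiLp.inner_apply, Fin.sum_univ_two]

theorem sum_prod_eq_pow {N : ℕ} (f : Fin 2 → ℂ) :
    ∑ A : Fin N → Fin 2, ∏ r, f (A r) = (f 0 + f 1) ^ N := by
  have h := Finset.prod_univ_sum (fun _ : Fin N => (Finset.univ : Finset (Fin 2))) (fun _ c => f c)
  rw [Fintype.piFinset_univ] at h
  rw [← h]
  simp [Fin.sum_univ_two]

/-- A sum over multi-indices of a product over slots factorises; this is what reduces spin `N/2` to
spin 1/2. -/
theorem inner_coherent (N : ℕ) (z z' : Spinor) :
    inner ℂ (coherent N z) (coherent N z') = (inner ℂ z z') ^ N := by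
  rw [inner_spinor, ← sum_prod_eq_pow (fun A => z' A * (starRingEnd ℂ) (z A)),
    Submodule.coe_inner, PiLp.inner_apply]
  refine Finset.sum_congr rfl fun A _ => ?_
  simp [coherent, Finset.prod_mul_distrib, map_prod]

theorem rho_coherent (N : ℕ) (g : SU2) (z : Spinor) :
    rho N g (coherent N z) = coherent N (act g z) := by
  ext A
  have h := Finset.prod_univ_sum (fun _ : Fin N => (Finset.univ : Finset (Fin 2)))
    (fun r c => (g : Matrix (Fin 2) (Fin 2) ℂ) (A r) c * z c)
  rw [Fintype.piFinset_univ] at h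
  simp only [Fin.sum_univ_two] at h
  change ∑ B : Fin N → Fin 2, (∏ r, (g : Matrix (Fin 2) (Fin 2) ℂ) (A r) (B r)) * ∏ r, z (B r) =
    ∏ r, (g.1 (A r) 0 * z 0 + g.1 (A r) 1 * z 1)
  rw [h]
  simp [Finset.prod_mul_distrib]

/-- `J` acts slot by slot, sending `z` to `(-z̄₁, z̄₀)`. -/
theorem inner_Jmap_coherent (N : ℕ) (z z' : Spinor) :
    inner ℂ (Jmap N (coherent N z)) (coherent N z') = eps2 z z' ^ N := by
  have hJ : Jmap N (coherent N z) = coherent N (WithLp.toLp 2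
      ![-(starRingEnd ℂ) (z 1), (starRingEnd ℂ) (z 0)]) := by
    ext A
    have h := Finset.prod_univ_sum (fun _ : Fin N => (Finset.univ : Finset (Fin 2)))
      (fun (r : Fin N) c => epsMat.transpose (A r) c * (starRingEnd ℂ) (z c))
    rw [Fintype.piFinset_univ] at h
    simp only [Fin.sum_univ_two] at h
    change ∑ B : Fin N → Fin 2, (∏ r, epsMat.transpose (A r) (B r)) *
      (starRingEnd ℂ) (∏ r, z (B r)) = ∏ r : Fin N,
        (![-(starRingEnd ℂ) (z 1), (starRingEnd ℂ) (z 0)] : Fin 2 → ℂ) (A r)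
    have h3 : ∀ c : Fin 2, epsMat.transpose c 0 * (starRingEnd ℂ) (z 0) +
        epsMat.transpose c 1 * (starRingEnd ℂ) (z 1) =
        (![-(starRingEnd ℂ) (z 1), (starRingEnd ℂ) (z 0)] : Fin 2 → ℂ) c := by
      intro c
      fin_cases c <;> simp [epsMat]
    simp only [h3] at h
    rw [h]
    simp [Finset.prod_mul_distrib, map_prod]
  rw [hJ, inner_coherent, inner_spinor]
  congr 1
  simp [eps2]
  ring

theorem coherent_smul (N : ℕ) (c : ℂ) (z : Spinor) :
    coherent N (c • z) = c ^ N • coherent N z := by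
  ext A
  change ∏ r, (c * z (A r)) = c ^ N * ∏ r, z (A r)
  simp [Finset.prod_mul_distrib]

/-! ### Coherent spinors and the unit sphere -/

theorem su2_eq (v : R3) : su2 v = (-Complex.I / 2) •
    !![(v 2 : ℂ), v 0 - Complex.I * v 1; v 0 + Complex.I * v 1, -(v 2 : ℂ)] := by
  ext i j
  fin_cases i <;> fin_cases j <;> simp [su2, tau, pauli, Fin.sum_univ_three] <;> ring

theorem su2_injective : Function.Injective su2 := by
  intro v v' h
  rw [su2_eq, su2_eq] at h
  have h1 := congrFun (congrFun h 0) 0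
  have h2 := congrFun (congrFun h 0) 1
  have e1 := congrArg Complex.im h1
  have e2 := congrArg Complex.im h2
  have e3 := congrArg Complex.re h2
  simp at e1 e2 e3
  ext i
  fin_cases i
  · simpa using by linarith
  · simpa using by linarith
  · simpa using by linarith

theorem norm_spinor_sq (z : Spinor) :
    z 0 * (starRingEnd ℂ) (z 0) + z 1 * (starRingEnd ℂ) (z 1) = (‖z‖ : ℂ) ^ 2 := by
  rw [← inner_spinor, inner_self_eq_norm_sq_to_K]
  rfl

theorem IsCoherentSpinor.eqs {n : UnitVec} {z : Spinor} (h : IsCoherentSpinor n z) :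
    ((n : R3) 2 : ℂ) * z 0 + ((n : R3) 0 - Complex.I * (n : R3) 1) * z 1 = z 0 ∧
    ((n : R3) 0 + Complex.I * (n : R3) 1) * z 0 - ((n : R3) 2 : ℂ) * z 1 = z 1 := by
  have h0 := h.2 0
  have h1 := h.2 1
  simp [pauli, Fin.sum_univ_three] at h0 h1
  constructor
  · linear_combination 2 * h0
  · linear_combination 2 * h1

/-- The density matrix `(1 + n·σ)/2`, with `n·σ/2 = i su2 n`. It forgets the phase of `z` and
nothing else. -/
theorem IsCoherentSpinor.outer_eq {n : UnitVec} {z : Spinor} (h : IsCoherentSpinor n z) :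
    outer z = (1 / 2 : ℂ) • (1 : Matrix (Fin 2) (Fin 2) ℂ) + Complex.I • su2 n := by
  obtain ⟨h0, h1⟩ := h.eqs
  have hn := norm_spinor_sq z
  rw [h.1] at hn
  push_cast at hn
  have c0 := congrArg (starRingEnd ℂ) h0
  have c1 := congrArg (starRingEnd ℂ) h1
  simp only [map_add, map_sub, map_mul, Complex.conj_ofReal, Complex.conj_I] at c0 c1
  have hI := Complex.I_mul_I
  have a : 2 * (z 0 * (starRingEnd ℂ) (z 1)) = (n : R3) 0 - Complex.I * (n : R3) 1 := by
    linear_combination (-(starRingEnd ℂ) (z 1)) * h0 - z 0 * c1 +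
      ((n : R3) 0 - Complex.I * (n : R3) 1) * hn
  have a' : 2 * (z 1 * (starRingEnd ℂ) (z 0)) = (n : R3) 0 + Complex.I * (n : R3) 1 := by
    linear_combination (-(starRingEnd ℂ) (z 0)) * h1 - z 1 * c0 +
      ((n : R3) 0 + Complex.I * (n : R3) 1) * hn
  have b : ((n : R3) 2 : ℂ) = z 0 * (starRingEnd ℂ) (z 0) - z 1 * (starRingEnd ℂ) (z 1) := by
    linear_combination (starRingEnd ℂ) (z 0) * h0 - (starRingEnd ℂ) (z 1) * h1 +
      (z 1 * (starRingEnd ℂ) (z 0)) * a - (z 0 * (starRingEnd ℂ) (z 1)) * a' - ((n : R3) 2 : ℂ) * hn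
  rw [su2_eq]
  ext i j
  fin_cases i <;> fin_cases j <;> simp [outer]
  · linear_combination (1 / 2 : ℂ) * hn - (1 / 2 : ℂ) * b + (1 / 2 : ℂ) * (n : R3) 2 * hI
  · linear_combination (1 / 2 : ℂ) * a + (1 / 2 : ℂ) * ((n : R3) 0 - Complex.I * (n : R3) 1) * hI
  · linear_combination (1 / 2 : ℂ) * a' + (1 / 2 : ℂ) * ((n : R3) 0 + Complex.I * (n : R3) 1) * hI
  · linear_combination (1 / 2 : ℂ) * hn + (1 / 2 : ℂ) * b - (1 / 2 : ℂ) * (n : R3) 2 * hI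

/-- Lagrange's identity. For unit spinors `|ε| = 1` says orthogonal, and `|⟨u,v⟩| = 1` says
parallel. -/
theorem eps2_inner_identity (u v : Spinor) :
    ‖eps2 u v‖ ^ 2 + ‖(inner ℂ u v : ℂ)‖ ^ 2 = ‖u‖ ^ 2 * ‖v‖ ^ 2 := by
  have hu := norm_spinor_sq u
  have hv := norm_spinor_sq v
  have h : ((‖eps2 u v‖ ^ 2 + ‖(inner ℂ u v : ℂ)‖ ^ 2 : ℝ) : ℂ) = ((‖u‖ ^ 2 * ‖v‖ ^ 2 : ℝ) : ℂ) := by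
    push_cast
    rw [← Complex.mul_conj', ← Complex.mul_conj', ← hu, ← hv, inner_spinor, eps2]
    simp only [map_add, map_sub, map_mul, Complex.conj_conj]
    ring
  exact_mod_cast h

theorem eps2_resolution (u v x : Spinor) (h : outer u + outer v = 1) :
    (∀ A, x A = inner ℂ u x * u A + inner ℂ v x * v A) := by
  have e : ∀ A B, u A * (starRingEnd ℂ) (u B) + v A * (starRingEnd ℂ) (v B) =
      (1 : Matrix (Fin 2) (Fin 2) ℂ) A B := fun A B => congrFun (congrFun h A) B
  have h00 := e 0 0
  have h01 := e 0 1
  have h10 := e 1 0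
  have h11 := e 1 1
  rw [inner_spinor, inner_spinor]
  simp at h00 h01 h10 h11
  refine Fin.forall_fin_two.2 ⟨?_, ?_⟩
  · linear_combination (-x 0) * h00 - x 1 * h01
  · linear_combination (-x 0) * h10 - x 1 * h11

theorem outer_add_outer_of_norm_eps2 {u v : Spinor} (hu : ‖u‖ = 1) (hv : ‖v‖ = 1)
    (h : ‖eps2 u v‖ = 1) : outer u + outer v = 1 := by
  have hi := eps2_inner_identity u v
  rw [hu, hv, h] at hi
  have h0 : (inner ℂ u v : ℂ) = 0 := by
    have : ‖(inner ℂ u v : ℂ)‖ ^ 2 = 0 := by linarith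
    simpa using this
  have h0' := congrArg (starRingEnd ℂ) h0
  have e0 := norm_spinor_sq u
  have e1 := norm_spinor_sq v
  rw [inner_spinor] at h0 h0'
  rw [hu] at e0
  rw [hv] at e1
  simp only [map_add, map_mul, map_zero, Complex.conj_conj] at h0'
  push_cast at e0 e1
  have key : (Matrix.of ![![(starRingEnd ℂ) (u 0), (starRingEnd ℂ) (u 1)],
      ![(starRingEnd ℂ) (v 0), (starRingEnd ℂ) (v 1)]]) *
      (Matrix.of ![![u 0, v 0], ![u 1, v 1]]) = 1 := by
    ext i j
    fin_cases i <;> fin_cases j <;> simp [Matrix.mul_apply, Fin.sum_univ_two]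
    · linear_combination e0
    · linear_combination h0
    · linear_combination h0'
    · linear_combination e1
  -- A one-sided inverse of a square matrix is two-sided: orthonormality of `u, v` becomes
  -- completeness.
  rw [mul_eq_one_comm] at key
  rw [← key]
  ext i j
  fin_cases i <;> fin_cases j <;> simp [outer, Matrix.mul_apply, Fin.sum_univ_two]

/-- Expanding `v` itself by completeness gives `v = ⟨u,v⟩ u + v`, so `⟨u,v⟩ = 0`. -/
theorem norm_eps2_of_outer_add {u v : Spinor} (hu : ‖u‖ = 1) (hv : ‖v‖ = 1)
    (h : outer u + outer v = 1) : ‖eps2 u v‖ = 1 := by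
  have hi := eps2_inner_identity u v
  have hr := eps2_resolution u v v h
  have hvv : (inner ℂ v v : ℂ) = 1 := by
    rw [inner_self_eq_norm_sq_to_K, hv]; simp
  have h2 : ∀ A, (inner ℂ u v : ℂ) * u A = 0 := by
    intro A
    have := hr A
    rw [hvv] at this
    linear_combination -this
  have h0 : (inner ℂ u v : ℂ) = 0 := by
    by_contra hne
    have hz : u = 0 := by
      ext A
      simpa [hne] using h2 A
    rw [hz] at hu
    simp at hu
  rw [hu, hv, h0] at hi
  have := norm_nonneg (eps2 u v)
  have h3 : ‖eps2 u v‖ ^ 2 = 1 := by simpa using hi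
  nlinarith

theorem eq_inner_smul_of_norm_inner {u v : Spinor} (hu : ‖u‖ = 1) (hv : ‖v‖ = 1)
    (h : ‖(inner ℂ u v : ℂ)‖ = 1) : v = (inner ℂ u v : ℂ) • u := by
  have hi := eps2_inner_identity u v
  rw [hu, hv, h] at hi
  have h0 : eps2 u v = 0 := by
    have : ‖eps2 u v‖ ^ 2 = 0 := by linarith
    simpa using this
  have e0 := norm_spinor_sq u
  rw [hu] at e0
  push_cast at e0
  rw [inner_spinor]
  rw [eps2] at h0
  ext A
  fin_cases A
  · simp
    linear_combination (-v 0) * e0 - (starRingEnd ℂ) (u 1) * h0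
  · simp
    linear_combination (-v 1) * e0 + (starRingEnd ℂ) (u 0) * h0

theorem outer_smul (c : ℂ) (hc : ‖c‖ = 1) (u : Spinor) : outer (c • u) = outer u := by
  have h : c * (starRingEnd ℂ) c = 1 := by rw [Complex.mul_conj', hc]; simp
  ext A B
  simp [outer]
  linear_combination (u A * (starRingEnd ℂ) (u B)) * h

theorem norm_inner_of_outer_eq {u v : Spinor} (hu : ‖u‖ = 1)
    (h : outer u = outer v) : ‖(inner ℂ u v : ℂ)‖ = 1 := by
  have e : ∀ A B, u A * (starRingEnd ℂ) (u B) = v A * (starRingEnd ℂ) (v B) :=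
    fun A B => congrFun (congrFun h A) B
  have e0 := norm_spinor_sq u
  rw [hu] at e0
  push_cast at e0
  have h2 : ((‖(inner ℂ u v : ℂ)‖ ^ 2 : ℝ) : ℂ) = 1 := by
    push_cast
    rw [← Complex.mul_conj', inner_spinor]
    simp only [map_add, map_mul, Complex.conj_conj]
    linear_combination (-(u 0) * (starRingEnd ℂ) (u 0)) * e 0 0 - (u 1 * (starRingEnd ℂ) (u 0)) * e 0 1
      - (u 0 * (starRingEnd ℂ) (u 1)) * e 1 0 - (u 1 * (starRingEnd ℂ) (u 1)) * e 1 1 +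
      (u 0 * (starRingEnd ℂ) (u 0) + u 1 * (starRingEnd ℂ) (u 1) + 1) * e0
  have h3 : ‖(inner ℂ u v : ℂ)‖ ^ 2 = 1 := by exact_mod_cast h2
  have := norm_nonneg (inner ℂ u v : ℂ)
  nlinarith

theorem IsCoherentSpinor.norm_inner {n : UnitVec} {z z' : Spinor} (h : IsCoherentSpinor n z)
    (h' : IsCoherentSpinor n z') : ‖(inner ℂ z z' : ℂ)‖ = 1 :=
  norm_inner_of_outer_eq h.1 (by rw [h.outer_eq, h'.outer_eq])

theorem IsCoherentSpinor.exists_phase {n : UnitVec} {z z' : Spinor} (h : IsCoherentSpinor n z)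
    (h' : IsCoherentSpinor n z') : ∃ c : ℂ, ‖c‖ = 1 ∧ z' = c • z :=
  ⟨_, h.norm_inner h', eq_inner_smul_of_norm_inner h.1 h'.1 (h.norm_inner h')⟩

theorem IsCoherentSpinor.eq_of_norm_inner {n n' : UnitVec} {z z' : Spinor}
    (h : IsCoherentSpinor n z) (h' : IsCoherentSpinor n' z') (hi : ‖(inner ℂ z z' : ℂ)‖ = 1) :
    n = n' := by
  have e : outer z' = outer z := by
    conv_lhs => rw [eq_inner_smul_of_norm_inner h.1 h'.1 hi]
    exact outer_smul _ hi _
  rw [h.outer_eq, h'.outer_eq] at e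
  have e2 := add_left_cancel e
  have e3 := smul_right_injective _ Complex.I_ne_zero e2
  exact Subtype.ext (su2_injective e3.symm)

/-! ### The action of `SU(2)` on spinors and the orientation condition -/

theorem act_mul (X Y : Matrix (Fin 2) (Fin 2) ℂ) (u : Spinor) :
    act (X * Y) u = act X (act Y u) := by
  ext A
  simp [act, Matrix.mul_apply, Fin.sum_univ_two]
  ring

theorem SU2_conjTranspose (X : SU2) :
    (X⁻¹ : SU2).1 = (X : Matrix (Fin 2) (Fin 2) ℂ).conjTranspose := rfl

theorem SU2_norm (X : SU2) : X.1 0 0 * (starRingEnd ℂ) (X.1 0 0) +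
    X.1 0 1 * (starRingEnd ℂ) (X.1 0 1) = 1 := by
  have hd := (Matrix.mem_specialUnitaryGroup_iff.1 X.2).2
  obtain ⟨h1, h2⟩ := SU2_entries X
  rw [Matrix.det_fin_two, h1, h2] at hd
  linear_combination hd

theorem eps2_act (X : SU2) (u v : Spinor) : eps2 (act X.1 u) (act X.1 v) = eps2 u v := by
  have hd := (Matrix.mem_specialUnitaryGroup_iff.1 X.2).2
  rw [Matrix.det_fin_two] at hd
  simp [eps2, act]
  linear_combination (u 0 * v 1 - u 1 * v 0) * hd

/-- Invariance of `ε` under `SU(2)` separates the dependence on the two group elements. -/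
theorem eps2_act_rel (X Y : SU2) (u v : Spinor) :
    eps2 u (act (X⁻¹ * Y : SU2).1 v) = eps2 (act X.1 u) (act Y.1 v) := by
  rw [← eps2_act X, ← act_mul]
  congr 2
  rw [← Submonoid.coe_mul, mul_inv_cancel_left]

theorem inner_act (X : SU2) (u v : Spinor) :
    (inner ℂ (act X.1 u) (act X.1 v) : ℂ) = inner ℂ u v := by
  obtain ⟨h1, h2⟩ := SU2_entries X
  have h := SU2_norm X
  rw [inner_spinor, inner_spinor]
  simp [act, h1, h2]
  linear_combination (v 0 * (starRingEnd ℂ) (u 0) + v 1 * (starRingEnd ℂ) (u 1)) * h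

theorem norm_act (X : SU2) (u : Spinor) : ‖act X.1 u‖ = ‖u‖ := by
  have h := inner_act X u u
  rw [inner_self_eq_norm_sq_to_K, inner_self_eq_norm_sq_to_K] at h
  have h' : ‖act X.1 u‖ ^ 2 = ‖u‖ ^ 2 := by exact_mod_cast h
  exact (pow_left_inj₀ (norm_nonneg _) (norm_nonneg _) two_ne_zero).1 h'

theorem outer_act (X : SU2) (u : Spinor) :
    outer (act X.1 u) = X.1 * outer u * (X⁻¹ : SU2).1 := by
  rw [SU2_conjTranspose]
  ext A B
  simp [outer, act, Matrix.mul_apply, Fin.sum_univ_two]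
  ring

theorem IsCoherentSpinor.outer_act {n : UnitVec} {z : Spinor} (h : IsCoherentSpinor n z) (X : SU2) :
    outer (act X.1 z) = (1 / 2 : ℂ) • (1 : Matrix (Fin 2) (Fin 2) ℂ) + Complex.I • adjoint X n := by
  rw [ProperEPRL.outer_act, h.outer_eq, adjoint]
  have : X.1 * (X⁻¹ : SU2).1 = 1 := by rw [← Submonoid.coe_mul, mul_inv_cancel]; rfl
  simp only [mul_add, add_mul, Matrix.mul_smul, Matrix.smul_mul, mul_one, this]

/-- The rotated density matrices are `1/2 + i X▷n` and `1/2 + i Y▷n'`; they sum to the identity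
exactly when the vectors are antipodal. -/
theorem IsCoherentSpinor.norm_eps2_act_iff {n n' : UnitVec} {z z' : Spinor}
    (h : IsCoherentSpinor n z) (h' : IsCoherentSpinor n' z') (X Y : SU2) :
    ‖eps2 (act X.1 z) (act Y.1 z')‖ = 1 ↔ adjoint X n = -adjoint Y n' := by
  have hu : ‖act X.1 z‖ = 1 := by rw [norm_act, h.1]
  have hv : ‖act Y.1 z'‖ = 1 := by rw [norm_act, h'.1]
  have e : outer (act X.1 z) + outer (act Y.1 z') = 1 + Complex.I • (adjoint X n + adjoint Y n') := by
    rw [h.outer_act, h'.outer_act]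
    module
  constructor
  · intro h1
    have := outer_add_outer_of_norm_eps2 hu hv h1
    rw [e] at this
    have h2 : Complex.I • (adjoint X n + adjoint Y n') = 0 := by simpa using this
    rw [smul_eq_zero_iff_right Complex.I_ne_zero] at h2
    exact eq_neg_of_add_eq_zero_left h2
  · intro h1
    refine norm_eps2_of_outer_add hu hv ?_
    rw [e, h1]
    simp

theorem norm_eps2_le {u v : Spinor} (hu : ‖u‖ = 1) (hv : ‖v‖ = 1) : ‖eps2 u v‖ ≤ 1 := by
  have h := eps2_inner_identity u v
  rw [hu, hv] at h
  nlinarith [sq_nonneg ‖(inner ℂ u v : ℂ)‖, norm_nonneg (eps2 u v)]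

/-! ### Positive spectral projections -/

section Spectral

variable {V : Type*} [NormedAddCommGroup V] [InnerProductSpace ℂ V]

theorem mem_orthogonal_positive {T : V →ₗ[ℂ] V} (hT : T.IsSymmetric) {x : V} {μ : ℝ} (hμ : μ ≤ 0)
    (hx : T x = (μ : ℂ) • x) :
    x ∈ (⨆ μ : {μ : ℝ // 0 < μ}, Module.End.eigenspace T ((μ : ℝ) : ℂ))ᗮ := by
  rw [← Submodule.iInf_orthogonal, Submodule.mem_iInf]
  intro ν
  rw [Submodule.mem_orthogonal]
  intro y hy
  have hne : ((ν : ℝ) : ℂ) ≠ (μ : ℂ) := by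
    have := ν.2
    exact_mod_cast (by linarith : μ < (ν : ℝ)).ne'
  have := hT.orthogonalFamily_eigenspaces hne ⟨y, hy⟩ ⟨x, Module.End.mem_eigenspace_iff.2 hx⟩
  simpa using this

variable [FiniteDimensional ℂ V]

theorem positiveSpectralProj_of_pos {T : V →ₗ[ℂ] V} {x : V} {μ : ℝ} (hμ : 0 < μ)
    (hx : T x = (μ : ℂ) • x) : positiveSpectralProj T x = x := by
  rw [positiveSpectralProj, Submodule.starProjection_eq_self_iff]
  exact Submodule.mem_iSup_of_mem (⟨μ, hμ⟩ : {μ : ℝ // 0 < μ}) (Module.End.mem_eigenspace_iff.2 hx)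

theorem positiveSpectralProj_of_nonpos {T : V →ₗ[ℂ] V} (hT : T.IsSymmetric) {x : V} {μ : ℝ}
    (hμ : μ ≤ 0) (hx : T x = (μ : ℂ) • x) : positiveSpectralProj T x = 0 := by
  rw [positiveSpectralProj, Submodule.starProjection_apply_eq_zero_iff]
  exact mem_orthogonal_positive hT hμ hx

/-- In an eigenbasis, the components removed by the projection are kept by `1 - P` and have
eigenvalue `l ≤ 0`, so `|l - r| ≥ r`. An approximate eigenvector for `r > 0` is therefore almost
fixed, with no assumption on spectral gaps of `T`. -/
theorem norm_sub_positiveSpectralProj_le {T : V →ₗ[ℂ] V} (hT : T.IsSymmetric) (x : V) {r : ℝ}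
    (hr : 0 < r) : r * ‖x - positiveSpectralProj T x‖ ≤ ‖T x - (r : ℂ) • x‖ := by
  set e := hT.eigenvectorBasis rfl
  have h1 := e.sum_sq_norm_inner_right (x - positiveSpectralProj T x)
  have h2 := e.sum_sq_norm_inner_right (T x - (r : ℂ) • x)
  have key : ∀ i, r ^ 2 * ‖(inner ℂ (e i) (x - positiveSpectralProj T x) : ℂ)‖ ^ 2 ≤
      ‖(inner ℂ (e i) (T x - (r : ℂ) • x) : ℂ)‖ ^ 2 := by
    intro i
    have he : T (e i) = ((hT.eigenvalues rfl i : ℝ) : ℂ) • e i := hT.apply_eigenvectorBasis rfl i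
    generalize hT.eigenvalues rfl i = l at he
    have hin : (inner ℂ (e i) (T x - (r : ℂ) • x) : ℂ) = ((l - r : ℝ) : ℂ) * inner ℂ (e i) x := by
      rw [inner_sub_right, inner_smul_right, ← hT, he, inner_smul_left]
      simp
      ring
    rcases lt_or_ge 0 l with hl | hl
    · have hm : e i ∈ (⨆ μ : {μ : ℝ // 0 < μ}, Module.End.eigenspace T ((μ : ℝ) : ℂ)) :=
        Submodule.mem_iSup_of_mem (⟨l, hl⟩ : {μ : ℝ // 0 < μ}) (Module.End.mem_eigenspace_iff.2 he)
      have h0 : (inner ℂ (e i) (x - positiveSpectralProj T x) : ℂ) = 0 :=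
        Submodule.inner_right_of_mem_orthogonal hm (Submodule.sub_starProjection_mem_orthogonal x)
      rw [h0]
      simp
    · have h0 : (inner ℂ (e i) (positiveSpectralProj T x) : ℂ) = 0 :=
        Submodule.inner_left_of_mem_orthogonal (Submodule.starProjection_apply_mem _ x)
          (mem_orthogonal_positive hT hl he)
      rw [inner_sub_right, h0, sub_zero, hin, norm_mul, mul_pow, Complex.norm_real,
        Real.norm_eq_abs, sq_abs]
      refine mul_le_mul_of_nonneg_right ?_ (sq_nonneg _)
      nlinarith
  have h3 := Finset.sum_le_sum fun i (_ : i ∈ Finset.univ) => key i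
  rw [← Finset.mul_sum, h1, h2] at h3
  rw [← mul_pow] at h3
  exact (pow_le_pow_iff_left₀ (by positivity) (norm_nonneg _) two_ne_zero).1 h3

theorem norm_positiveSpectralProj_le (T : V →ₗ[ℂ] V) (x : V) : ‖positiveSpectralProj T x‖ ≤ ‖x‖ :=
  Submodule.norm_starProjection_apply_le _ x

theorem positiveSpectralProj_eq_self_of_norm {T : V →ₗ[ℂ] V} {x : V}
    (h : ‖x‖ ≤ ‖positiveSpectralProj T x‖) : positiveSpectralProj T x = x := by
  rw [positiveSpectralProj, Submodule.starProjection_eq_self_iff,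
    Submodule.mem_iff_norm_starProjection]
  exact le_antisymm (norm_positiveSpectralProj_le T x) h

/-- The correction to `⟨x,y⟩` is bilinear in the two defects, hence of second order when both are of
first order. -/
theorem inner_positiveSpectralProj (T : V →ₗ[ℂ] V) (x y : V) :
    (inner ℂ x (positiveSpectralProj T y) : ℂ) = inner ℂ x y -
      inner ℂ (x - positiveSpectralProj T x) (y - positiveSpectralProj T y) := by
  have h1 : (inner ℂ (positiveSpectralProj T x) (y - positiveSpectralProj T y) : ℂ) = 0 :=
    Submodule.inner_right_of_mem_orthogonal (Submodule.starProjection_apply_mem _ x)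
      (Submodule.sub_starProjection_mem_orthogonal y)
  rw [inner_sub_left, h1, inner_sub_right]
  ring

end Spectral

/-! ### Self-adjointness of the generators and their coherent eigenvectors -/

theorem rhoLie_skew (N : ℕ) (x : Matrix (Fin 2) (Fin 2) ℂ)
    (hx : ∀ A B, (starRingEnd ℂ) (x A B) = -x B A) (ψ φ : SymSpinor N) :
    (inner ℂ (rhoLie N x ψ) φ : ℂ) = -inner ℂ ψ (rhoLie N x φ) := by
  rw [Submodule.coe_inner, Submodule.coe_inner, PiLp.inner_apply, PiLp.inner_apply]
  have h1 : ∀ A, (inner ℂ ((rhoLie N x ψ).1 A) (φ.1 A) : ℂ) = ∑ r, ∑ c, (starRingEnd ℂ)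
      (x (A r) c) * (starRingEnd ℂ) (ψ.1 (Function.update A r c)) * φ.1 A := by
    intro A
    change φ.1 A * (starRingEnd ℂ) (∑ r, ∑ c, x (A r) c * ψ.1 (Function.update A r c)) = _
    simp [Finset.mul_sum, map_sum, mul_comm, mul_add]
  have h2 : ∀ A, (inner ℂ (ψ.1 A) ((rhoLie N x φ).1 A) : ℂ) = ∑ r, ∑ c,
      x (A r) c * φ.1 (Function.update A r c) * (starRingEnd ℂ) (ψ.1 A) := by
    intro A
    change (∑ r, ∑ c, x (A r) c * φ.1 (Function.update A r c)) * (starRingEnd ℂ) (ψ.1 A) = _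
    simp [Finset.sum_mul, add_mul]
  simp only [h1, h2]
  rw [Finset.sum_comm, Finset.sum_comm (f := fun A r => ∑ c,
      x (A r) c * φ.1 (Function.update A r c) * (starRingEnd ℂ) (ψ.1 A)), ← Finset.sum_neg_distrib]
  refine Finset.sum_congr rfl fun r _ => ?_
  rw [← Fintype.sum_prod_type', ← Fintype.sum_prod_type', ← Finset.sum_neg_distrib]
  -- Exchanging the value in slot `r` with the summed index `c` matches the terms of the two sums.
  have hinv : Function.Involutive fun p : (Fin N → Fin 2) × Fin 2 =>
      (Function.update p.1 r p.2, p.1 r) := by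
    intro p
    simp
  refine Fintype.sum_equiv hinv.toPerm _ _ fun p => ?_
  simp [hx]
  ring

theorem tau_skew (i : Fin 3) (A B : Fin 2) : (starRingEnd ℂ) (tau i A B) = -tau i B A := by
  have h2 : (starRingEnd ℂ) (2 : ℂ) = 2 := map_ofNat _ 2
  fin_cases i <;> fin_cases A <;> fin_cases B <;> simp [tau, pauli, h2, neg_div]

theorem SymSpinor.inner_smul_left {N : ℕ} (c : ℂ) (ψ φ : SymSpinor N) :
    (inner ℂ (c • ψ) φ : ℂ) = (starRingEnd ℂ) c * inner ℂ ψ φ :=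
  _root_.inner_smul_left (𝕜 := ℂ) (E := SymSpinor N) ψ φ c

theorem SymSpinor.inner_smul_right {N : ℕ} (c : ℂ) (ψ φ : SymSpinor N) :
    (inner ℂ ψ (c • φ) : ℂ) = c * inner ℂ ψ φ :=
  _root_.inner_smul_right (𝕜 := ℂ) (E := SymSpinor N) ψ φ c

theorem Lgen_isSymmetric (N : ℕ) (i : Fin 3) : LinearMap.IsSymmetric (𝕜 := ℂ) (E := SymSpinor N) (Lgen N i) := by
  intro ψ φ
  change (inner ℂ (Complex.I • rhoLie N (tau i) ψ) φ : ℂ) =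
    inner ℂ ψ (Complex.I • rhoLie N (tau i) φ)
  rw [SymSpinor.inner_smul_left, SymSpinor.inner_smul_right, rhoLie_skew N _ (tau_skew i)]
  simp

theorem dotL_apply (N : ℕ) (v : Fin 3 → ℝ) (ψ : SymSpinor N) :
    dotL N v ψ = ∑ i, (v i : ℂ) • Lgen N i ψ := by
  simp [dotL]

theorem dotL_isSymmetric (N : ℕ) (v : Fin 3 → ℝ) : LinearMap.IsSymmetric (𝕜 := ℂ) (E := SymSpinor N) (dotL N v) := by
  intro ψ φ
  rw [dotL_apply, dotL_apply, sum_inner, inner_sum]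
  refine Finset.sum_congr rfl fun i _ => ?_
  rw [SymSpinor.inner_smul_left, SymSpinor.inner_smul_right, Complex.conj_ofReal, Lgen_isSymmetric N i ψ φ]

theorem dotL_smul (N : ℕ) (c : ℝ) (v : Fin 3 → ℝ) (ψ : SymSpinor N) :
    dotL N (fun i => c * v i) ψ = (c : ℂ) • dotL N v ψ := by
  rw [dotL_apply, dotL_apply, Finset.smul_sum]
  simp [mul_smul]

theorem dotL_coherent (N : ℕ) (c : ℝ) {n : UnitVec} {z : Spinor} (hz : IsCoherentSpinor n z) :
    dotL N (fun i => c * (n : R3) i) (coherent N z) = ((c * (N / 2) : ℝ) : ℂ) • coherent N z := by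
  rw [dotL_smul, (coherent_spec N n z hz).2, smul_smul]
  push_cast
  rfl

theorem IsCoherentSpinor.bilinear {n : UnitVec} {z : Spinor} (h : IsCoherentSpinor n z) :
    z 0 * (starRingEnd ℂ) (z 0) = (1 + (n : R3) 2) / 2 ∧
    z 1 * (starRingEnd ℂ) (z 1) = (1 - (n : R3) 2) / 2 ∧
    z 0 * (starRingEnd ℂ) (z 1) = ((n : R3) 0 - Complex.I * (n : R3) 1) / 2 ∧
    z 1 * (starRingEnd ℂ) (z 0) = ((n : R3) 0 + Complex.I * (n : R3) 1) / 2 := by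
  have ho := h.outer_eq
  rw [su2_eq] at ho
  have e : ∀ A B, z A * (starRingEnd ℂ) (z B) = _ := fun A B => congrFun (congrFun ho A) B
  have e00 := e 0 0
  have e11 := e 1 1
  have e01 := e 0 1
  have e10 := e 1 0
  have hI := Complex.I_mul_I
  simp at e00 e11 e01 e10
  refine ⟨?_, ?_, ?_, ?_⟩
  · linear_combination e00 - ((n : R3) 2 : ℂ) / 2 * hI
  · linear_combination e11 + ((n : R3) 2 : ℂ) / 2 * hI
  · linear_combination e01 - ((n : R3) 0 - Complex.I * (n : R3) 1) / 2 * hI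
  · linear_combination e10 - ((n : R3) 0 + Complex.I * (n : R3) 1) / 2 * hI

theorem inner_R3 (u v : R3) : inner ℝ u v = u 0 * v 0 + u 1 * v 1 + u 2 * v 2 := by
  simp [PiLp.inner_apply, Fin.sum_univ_three, mul_comm]

theorem UnitVec.sq_sum (n : UnitVec) :
    (n : R3) 0 ^ 2 + (n : R3) 1 ^ 2 + (n : R3) 2 ^ 2 = 1 := by
  have h : ‖(n : R3)‖ = 1 := by simp
  have h2 := real_inner_self_eq_norm_sq (n : R3)
  rw [h, inner_R3] at h2
  linarith

theorem UnitVec.sq_sum_complex (n : UnitVec) :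
    ((n : R3) 0 : ℂ) ^ 2 + ((n : R3) 1 : ℂ) ^ 2 + ((n : R3) 2 : ℂ) ^ 2 = 1 := by
  have h := congrArg Complex.ofReal n.sq_sum
  push_cast at h
  exact h

/-- The expectation value of a generator, the source of every nonzero term in the derivative of the
action. -/
theorem IsCoherentSpinor.inner_act_su2 {n : UnitVec} {z : Spinor} (h : IsCoherentSpinor n z)
    (ξ : R3) : (inner ℂ z (act (su2 ξ) z) : ℂ) = -(Complex.I / 2) * (inner ℝ ξ (n : R3) : ℝ) := by
  obtain ⟨h0, h1, h2, h3⟩ := h.bilinear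
  rw [inner_spinor, inner_R3, su2_eq]
  simp [act]
  linear_combination (-Complex.I / 2) * (((ξ 2 : ℂ)) * h0 - ξ 2 * h1 +
    (ξ 0 + Complex.I * ξ 1) * h2 + (ξ 0 - Complex.I * ξ 1) * h3) +
    (Complex.I / 2) * (ξ 1) * ((n : R3) 1) * Complex.I_mul_I

/-! ### First-order variation of coherent spinors -/

/-- The projection `½ (1 + n · σ) z` of a spinor. -/
def coherentProj (n : R3) (z : Spinor) : Spinor :=
  WithLp.toLp 2 ![((1 + n 2) * z 0 + (n 0 - Complex.I * n 1) * z 1) / 2,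
    ((n 0 + Complex.I * n 1) * z 0 + (1 - n 2) * z 1) / 2]

theorem IsCoherentSpinor.inner_coherentProj {n : UnitVec} {z : Spinor} (h : IsCoherentSpinor n z)
    (m : R3) : (inner ℂ z (coherentProj m z) : ℂ) = (((1 + inner ℝ (n : R3) m) / 2 : ℝ) : ℂ) := by
  obtain ⟨h0, h1, h2, h3⟩ := h.bilinear
  rw [inner_spinor, inner_R3]
  simp [coherentProj]
  linear_combination (1 + (m 2 : ℂ)) / 2 * h0 + (1 - (m 2 : ℂ)) / 2 * h1 +
    (m 0 + Complex.I * m 1) / 2 * h2 + (m 0 - Complex.I * m 1) / 2 * h3 -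
    (1 / 2) * (m 1) * ((n : R3) 1) * Complex.I_mul_I

/-- `½(1 + m·σ)` is self-adjoint and idempotent, the latter because `|m| = 1`. -/
theorem norm_coherentProj_sq (m : UnitVec) (z : Spinor) :
    ((‖coherentProj m z‖ ^ 2 : ℝ) : ℂ) = inner ℂ z (coherentProj m z) := by
  have hm : ((m : R3) 0 : ℂ) ^ 2 + ((m : R3) 1 : ℂ) ^ 2 + ((m : R3) 2 : ℂ) ^ 2 = 1 :=
    m.sq_sum_complex
  have h2 : (starRingEnd ℂ) (2 : ℂ) = 2 := map_ofNat _ 2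
  push_cast
  rw [← norm_spinor_sq, inner_spinor]
  simp [coherentProj, h2]
  linear_combination (z 0 * (starRingEnd ℂ) (z 0) + z 1 * (starRingEnd ℂ) (z 1)) / 4 * hm -
    (z 0 * (starRingEnd ℂ) (z 0) + z 1 * (starRingEnd ℂ) (z 1)) / 4 * ((m : R3) 1 : ℂ) ^ 2 *
      Complex.I_mul_I

theorem isCoherentSpinor_smul_coherentProj (m : UnitVec) (z : Spinor) (c : ℂ)
    (h : ‖c • coherentProj m z‖ = 1) : IsCoherentSpinor m (c • coherentProj m z) := by
  have hm : ((m : R3) 0 : ℂ) ^ 2 + ((m : R3) 1 : ℂ) ^ 2 + ((m : R3) 2 : ℂ) ^ 2 = 1 :=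
    m.sq_sum_complex
  refine ⟨h, Fin.forall_fin_two.2 ⟨?_, ?_⟩⟩
  · simp [pauli, Fin.sum_univ_three, coherentProj]
    linear_combination (c / 4) * z 0 * hm - (c / 4) * z 0 * ((m : R3) 1 : ℂ) ^ 2 * Complex.I_mul_I
  · simp [pauli, Fin.sum_univ_three, coherentProj]
    linear_combination (c / 4) * z 1 * hm - (c / 4) * z 1 * ((m : R3) 1 : ℂ) ^ 2 * Complex.I_mul_I

theorem IsCoherentSpinor.coherentProj_self {n : UnitVec} {z : Spinor} (h : IsCoherentSpinor n z) :
    coherentProj n z = z := by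
  obtain ⟨h0, h1⟩ := h.eqs
  ext A
  fin_cases A
  · simp [coherentProj]
    linear_combination (1 / 2 : ℂ) * h0
  · simp [coherentProj]
    linear_combination (1 / 2 : ℂ) * h1

theorem hasDerivAt_conj {f : ℝ → ℂ} {f' : ℂ} {x : ℝ} (h : HasDerivAt f f' x) :
    HasDerivAt (fun t => (starRingEnd ℂ) (f t)) ((starRingEnd ℂ) f') x :=
  Complex.conjCLE.toContinuousLinearMap.hasFDerivAt.comp_hasDerivAt x h

/-- Near `t = 0`, a differentiable curve of unit vectors lifts to a differentiable curve of
coherent spinors, horizontal at `t = 0`. -/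
theorem exists_horizontal_lift {m : ℝ → UnitVec}
    (hm : DifferentiableAt ℝ (fun t => (m t : R3)) 0) {z₀ : Spinor}
    (h₀ : IsCoherentSpinor (m 0) z₀) :
    ∃ (z : ℝ → Spinor) (z' : Spinor), (∀ᶠ t in 𝓝 0, IsCoherentSpinor (m t) (z t)) ∧ z 0 = z₀ ∧
      (∀ A, HasDerivAt (fun t => z t A) (z' A) 0) ∧ (inner ℂ z₀ z' : ℂ) = 0 := by
  have hmi : ∀ i, HasDerivAt (fun t => (((m t : R3) i : ℝ) : ℂ))
      ((deriv (fun t => (m t : R3) i) 0 : ℝ) : ℂ) 0 := fun i =>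
    ((differentiableAt_euclidean.1 hm) i).hasDerivAt.ofReal_comp
  have hy : ∀ A, DifferentiableAt ℝ (fun t => coherentProj (m t) z₀ A) 0 := by
    have h0 := (hmi 0).differentiableAt
    have h1 := (hmi 1).differentiableAt
    have h2 := (hmi 2).differentiableAt
    refine Fin.forall_fin_two.2 ⟨?_, ?_⟩
    · simp only [coherentProj, Matrix.cons_val_zero]
      fun_prop
    · simp only [coherentProj, Matrix.cons_val_one, Matrix.cons_val_zero]
      fun_prop
  set y' : Spinor := WithLp.toLp 2 fun A => deriv (fun t => coherentProj (m t) z₀ A) 0 with hy'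
  have hyd : ∀ A, HasDerivAt (fun t => coherentProj (m t) z₀ A) (y' A) 0 := fun A =>
    (hy A).hasDerivAt
  set s : ℝ → ℝ := fun t => (1 + inner ℝ (m 0 : R3) (m t : R3)) / 2 with hs
  have hsd : DifferentiableAt ℝ s 0 := by
    have h1 : DifferentiableAt ℝ (fun t => inner ℝ (m 0 : R3) (m t : R3)) 0 :=
      (differentiableAt_const _).inner ℝ hm
    simp only [hs]
    fun_prop
  have hs0 : s 0 = 1 := by simp [hs]
  -- `s` is the squared norm of the projected spinor and attains its maximum 1 at `t = 0`. Its
  -- vanishing derivative makes the normalisation stationary and the velocity orthogonal to `z₀`.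
  have hs' : HasDerivAt s 0 0 := by
    have hmax : IsLocalMax s 0 := by
      refine Eventually.of_forall fun t => ?_
      rw [hs0]
      have := real_inner_le_norm (m 0 : R3) (m t : R3)
      simp at this
      simp only [hs]
      linarith
    have := hsd.hasDerivAt
    rwa [hmax.hasDerivAt_eq_zero this] at this
  have hin : ∀ t, (inner ℂ z₀ (coherentProj (m t) z₀) : ℂ) = ((s t : ℝ) : ℂ) := fun t =>
    h₀.inner_coherentProj (m t)
  have hnorm : ∀ t, ‖coherentProj (m t) z₀‖ ^ 2 = s t := by
    intro t
    have := norm_coherentProj_sq (m t) z₀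
    rw [hin] at this
    exact_mod_cast this
  refine ⟨fun t => (((Real.sqrt (s t))⁻¹ : ℝ) : ℂ) • coherentProj (m t) z₀, y', ?_, ?_, ?_, ?_⟩
  · have hpos : ∀ᶠ t in 𝓝 0, 0 < s t :=
      hsd.continuousAt.eventually (lt_mem_nhds (by rw [hs0]; norm_num))
    filter_upwards [hpos] with t ht
    refine isCoherentSpinor_smul_coherentProj _ _ _ ?_
    rw [norm_smul, ← Real.sqrt_sq (norm_nonneg (coherentProj (m t) z₀)), hnorm]
    simp [abs_of_nonneg (Real.sqrt_nonneg _), (Real.sqrt_pos.2 ht).ne']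
  · simp [hs0, h₀.coherentProj_self]
  · intro A
    have h1 : HasDerivAt (fun t => (Real.sqrt (s t))⁻¹) 0 0 := by
      have h2 := (hs'.sqrt (by rw [hs0]; norm_num)).inv (by rw [hs0]; norm_num)
      simp only [zero_div, neg_zero] at h2
      exact h2
    have h3 := h1.ofReal_comp.mul (hyd A)
    simp only [hs0, Real.sqrt_one, inv_one, Complex.ofReal_zero, Complex.ofReal_one, zero_mul,
      one_mul, zero_add] at h3
    exact h3
  · have h1 := ((hyd 0).mul_const ((starRingEnd ℂ) (z₀ 0))).add
      ((hyd 1).mul_const ((starRingEnd ℂ) (z₀ 1)))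
    have h2 : HasDerivAt (fun t => ((s t : ℝ) : ℂ)) ((0 : ℝ) : ℂ) 0 := hs'.ofReal_comp
    have h3 : (fun t => ((s t : ℝ) : ℂ)) = (fun t => coherentProj (m t) z₀ 0 * (starRingEnd ℂ) (z₀ 0))
        + fun t => coherentProj (m t) z₀ 1 * (starRingEnd ℂ) (z₀ 1) := by
      funext t
      rw [← hin, inner_spinor]
      rfl
    rw [h3] at h2
    rw [inner_spinor, h1.unique h2]
    simp

theorem hasDerivAt_inner_const {z : ℝ → Spinor} {z' ν : Spinor} {c : ℂ}
    (hz : ∀ A, HasDerivAt (fun t => z t A) (z' A) 0) (horth : (inner ℂ (z 0) z' : ℂ) = 0)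
    (hν : ν = c • z 0) : HasDerivAt (fun t => (inner ℂ (z t) ν : ℂ)) 0 0 := by
  have h := ((hasDerivAt_conj (hz 0)).const_mul (ν 0)).add ((hasDerivAt_conj (hz 1)).const_mul (ν 1))
  have h2 : ν 0 * (starRingEnd ℂ) (z' 0) + ν 1 * (starRingEnd ℂ) (z' 1) = 0 := by
    have h3 := congrArg (starRingEnd ℂ) horth
    rw [inner_spinor] at h3
    simp at h3
    rw [hν]
    simp
    linear_combination c * h3
  rw [h2] at h
  refine h.congr_of_eventuallyEq (Eventually.of_forall fun t => ?_)
  simp only [inner_spinor]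
  rfl

/-- Expand the velocities in the orthonormal basis `u, v`; `ε` vanishes on repeated arguments, so
only the diagonal components survive. -/
theorem hasDerivAt_eps2 {u v : ℝ → Spinor} {u' v' : Spinor}
    (hu : ∀ A, HasDerivAt (fun t => u t A) (u' A) 0)
    (hv : ∀ A, HasDerivAt (fun t => v t A) (v' A) 0)
    (h : outer (u 0) + outer (v 0) = 1) :
    HasDerivAt (fun t => eps2 (u t) (v t))
      (eps2 (u 0) (v 0) * (inner ℂ (u 0) u' + inner ℂ (v 0) v')) 0 := by
  have hd := ((hu 0).mul (hv 1)).sub ((hu 1).mul (hv 0))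
  have e1 := eps2_resolution _ _ u' h
  have e2 := eps2_resolution _ _ v' h
  have e : u' 0 * v 0 1 + u 0 0 * v' 1 - (u' 1 * v 0 0 + u 0 1 * v' 0) =
      eps2 (u 0) (v 0) * (inner ℂ (u 0) u' + inner ℂ (v 0) v') := by
    rw [e1 0, e1 1, e2 0, e2 1, eps2]
    ring
  rw [← e]
  exact hd

theorem hasDerivAt_act {X : ℝ → SU2} {ξ : R3} {z : ℝ → Spinor} {z' : Spinor}
    (hX : ∀ i j, HasDerivAt (fun t => (X t).1 i j) (((X 0).1 * su2 ξ) i j) 0)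
    (hz : ∀ A, HasDerivAt (fun t => z t A) (z' A) 0) (A : Fin 2) :
    HasDerivAt (fun t => act (X t).1 (z t) A)
      ((act ((X 0).1 * su2 ξ) (z 0) + act (X 0).1 z') A) 0 := by
  have h := ((hX A 0).mul (hz 0)).add ((hX A 1).mul (hz 1))
  have e : (act ((X 0).1 * su2 ξ) (z 0) + act (X 0).1 z') A =
      ((X 0).1 * su2 ξ) A 0 * z 0 0 + (X 0).1 A 0 * z' 0 +
        (((X 0).1 * su2 ξ) A 1 * z 0 1 + (X 0).1 A 1 * z' 1) := by
    simp only [act, PiLp.add_apply]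
    ring
  rw [e]
  exact h

/-- Horizontality removes the spinor velocities, leaving the expectation values of the generators.
-/
theorem hasDerivAt_eps2_act {X Y : ℝ → SU2} {ξ η : R3} {z y : ℝ → Spinor} {z' y' : Spinor}
    {n m : UnitVec}
    (hX : ∀ i j, HasDerivAt (fun t => (X t).1 i j) (((X 0).1 * su2 ξ) i j) 0)
    (hY : ∀ i j, HasDerivAt (fun t => (Y t).1 i j) (((Y 0).1 * su2 η) i j) 0)
    (hz : ∀ A, HasDerivAt (fun t => z t A) (z' A) 0)
    (hy : ∀ A, HasDerivAt (fun t => y t A) (y' A) 0)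
    (hz0 : (inner ℂ (z 0) z' : ℂ) = 0) (hy0 : (inner ℂ (y 0) y' : ℂ) = 0)
    (hn : IsCoherentSpinor n (z 0)) (hm : IsCoherentSpinor m (y 0))
    (h : ‖eps2 (act (X 0).1 (z 0)) (act (Y 0).1 (y 0))‖ = 1) :
    HasDerivAt (fun t => eps2 (act (X t).1 (z t)) (act (Y t).1 (y t)))
      (eps2 (act (X 0).1 (z 0)) (act (Y 0).1 (y 0)) *
        (-(Complex.I / 2) * ((inner ℝ ξ (n : R3) + inner ℝ η (m : R3) : ℝ) : ℂ))) 0 := by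
  have ho := outer_add_outer_of_norm_eps2 (by rw [norm_act, hn.1]) (by rw [norm_act, hm.1]) h
  have hd := hasDerivAt_eps2 (hasDerivAt_act hX hz) (hasDerivAt_act hY hy) ho
  rw [inner_add_right, inner_add_right, act_mul, act_mul, inner_act, inner_act, inner_act,
    inner_act, hz0, hy0, hn.inner_act_su2, hm.inner_act_su2] at hd
  convert hd using 2
  push_cast
  ring

/-- The velocity of a curve in `SU(2)` is a left translate of an element of `su(2)`. -/
theorem exists_su2_velocity {X : ℝ → SU2}
    (hX : ∀ i j, DifferentiableAt ℝ (fun t => (X t).1 i j) 0) :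
    ∃ ξ : R3, ∀ i j, HasDerivAt (fun t => (X t).1 i j) (((X 0).1 * su2 ξ) i j) 0 := by
  obtain ⟨p, hp⟩ : ∃ p, HasDerivAt (fun t => (X t).1 0 0) p 0 := ⟨_, (hX 0 0).hasDerivAt⟩
  obtain ⟨q, hq⟩ : ∃ q, HasDerivAt (fun t => (X t).1 0 1) q 0 := ⟨_, (hX 0 1).hasDerivAt⟩
  obtain ⟨e1, e2⟩ := SU2_entries (X 0)
  have e3 := SU2_norm (X 0)
  set a := (X 0).1 0 0 with ha
  set b := (X 0).1 0 1 with hb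
  have h11 : HasDerivAt (fun t => (X t).1 1 1) ((starRingEnd ℂ) p) 0 :=
    (hasDerivAt_conj hp).congr_of_eventuallyEq (Eventually.of_forall fun t => (SU2_entries (X t)).1)
  have h10 : HasDerivAt (fun t => (X t).1 1 0) (-(starRingEnd ℂ) q) 0 :=
    (hasDerivAt_conj hq).neg.congr_of_eventuallyEq
      (Eventually.of_forall fun t => (SU2_entries (X t)).2)
  have hn := ((hp.mul (hasDerivAt_conj hp)).add (hq.mul (hasDerivAt_conj hq)))
  have hc : HasDerivAt (fun _ : ℝ => (1 : ℂ)) 0 0 := hasDerivAt_const _ _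
  have h0 := hn.unique (hc.congr_of_eventuallyEq (Eventually.of_forall fun t => SU2_norm (X t)))
  simp only [← ha, ← hb] at h0
  -- `r` and `s` form the first row of `X⁻¹X'`. Differentiating `|a|² + |b|² = 1` makes `r`
  -- imaginary, so that `X⁻¹X'` lies in `su(2)`.
  set r := (starRingEnd ℂ) a * p + b * (starRingEnd ℂ) q with hr
  set s := (starRingEnd ℂ) a * q - b * (starRingEnd ℂ) p with hs
  have hr2 : r + (starRingEnd ℂ) r = 0 := by
    rw [hr]
    simp only [map_add, map_mul, Complex.conj_conj]
    linear_combination h0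
  have hrre : r.re = 0 := by
    have := congrArg Complex.re hr2
    simp at this
    linarith
  have hrI : (r.im : ℂ) * Complex.I = r := by
    apply Complex.ext <;> simp [hrre]
  have hsI : (s.re : ℂ) + s.im * Complex.I = s := Complex.re_add_im s
  have hsI' : (s.re : ℂ) - s.im * Complex.I = (starRingEnd ℂ) s := by
    apply Complex.ext <;> simp
  have hcs : (starRingEnd ℂ) s = a * (starRingEnd ℂ) q - (starRingEnd ℂ) b * p := by
    rw [hs]; simp
  have hcr : -r = a * (starRingEnd ℂ) p + (starRingEnd ℂ) b * q := by
    have : -r = (starRingEnd ℂ) r := by linear_combination -hr2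
    rw [this, hr]; simp
  have key : su2 (WithLp.toLp 2 ![-2 * s.im, -2 * s.re, -2 * r.im]) =
      !![r, s; -(starRingEnd ℂ) s, -r] := by
    rw [su2_eq]
    ext i j
    fin_cases i <;> fin_cases j <;> simp
    · linear_combination hrI
    · linear_combination hsI - (s.re : ℂ) * Complex.I_mul_I
    · linear_combination -hsI' + (s.re : ℂ) * Complex.I_mul_I
    · linear_combination -hrI
  refine ⟨WithLp.toLp 2 ![-2 * s.im, -2 * s.re, -2 * r.im], ?_⟩
  rw [key]
  refine Fin.forall_fin_two.2 ⟨Fin.forall_fin_two.2 ⟨?_, ?_⟩, Fin.forall_fin_two.2 ⟨?_, ?_⟩⟩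
  · convert hp using 1
    simp [Matrix.mul_apply, Fin.sum_univ_two, ← ha, ← hb]
    rw [hcs, hr]
    linear_combination p * e3
  · convert hq using 1
    simp [Matrix.mul_apply, Fin.sum_univ_two, ← ha, ← hb]
    linear_combination a * hs + b * hcr + q * e3
  · convert h10 using 1
    simp [Matrix.mul_apply, Fin.sum_univ_two, e1, e2]
    rw [hcs, hr]
    linear_combination (-(starRingEnd ℂ) q) * e3
  · convert h11 using 1
    simp [Matrix.mul_apply, Fin.sum_univ_two, e1, e2]
    linear_combination (-(starRingEnd ℂ) b) * hs + (starRingEnd ℂ) a * hcr + (starRingEnd ℂ) p * e3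

/-- A one-parameter subgroup of `SU(2)`. -/
def expTau (i : Fin 3) (t : ℝ) : SU2 :=
  -- This is `exp(t τ_i)`, the half angle coming from `τ_i² = -1/4`.
  ⟨((Real.cos (t / 2) : ℝ) : ℂ) • 1 + ((2 * Real.sin (t / 2) : ℝ) : ℂ) • tau i, by
    have h : ((Real.cos (t / 2) : ℝ) : ℂ) ^ 2 + ((Real.sin (t / 2) : ℝ) : ℂ) ^ 2 = 1 := by
      exact_mod_cast Real.cos_sq_add_sin_sq (t / 2)
    have h2 : (starRingEnd ℂ) (2 : ℂ) = 2 := map_ofNat _ 2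
    generalize Real.cos (t / 2) = c at h
    generalize Real.sin (t / 2) = s at h
    rw [Matrix.mem_specialUnitaryGroup_iff, Matrix.mem_unitaryGroup_iff]
    constructor
    · ext k l
      fin_cases i <;> fin_cases k <;> fin_cases l <;>
        simp [tau, pauli, Matrix.mul_apply, Fin.sum_univ_two, Matrix.star_apply, h2] <;>
        first
          | ring1
          | linear_combination h - (s : ℂ) ^ 2 * Complex.I_sq
          | linear_combination h + (s : ℂ) ^ 2 * (Complex.I ^ 2 - 1) * Complex.I_sq
    · rw [Matrix.det_fin_two]
      fin_cases i <;> simp [tau, pauli] <;>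
        first
          | ring1
          | linear_combination h - (s : ℂ) ^ 2 * Complex.I_sq
          | linear_combination h + (s : ℂ) ^ 2 * (Complex.I ^ 2 - 1) * Complex.I_sq⟩

/-! ### The projector factor to first order -/

theorem differentiableAt_coherent (N : ℕ) {z : ℝ → Spinor}
    (hz : ∀ A, DifferentiableAt ℝ (fun t => z t A) 0) :
    DifferentiableAt ℝ (fun t => coherent N (z t)) 0 := by
  have h1 : DifferentiableAt ℝ (fun t => ((coherent N (z t) : SymSpinor N) :
      EuclideanSpace ℂ (Fin N → Fin 2))) 0 := by
    refine (differentiableAt_piLp (𝕜 := ℝ) 2).2 fun A => ?_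
    change DifferentiableAt ℝ (fun t => ∏ r, z t (A r)) 0
    exact DifferentiableAt.fun_finsetProd fun r _ => hz (A r)
  -- The orthogonal projection is the identity on the subspace, so it transfers differentiability
  -- from the ambient space.
  have h2 := (((SymSpinor N).orthogonalProjectionOnto).restrictScalars ℝ).differentiableAt.comp
    (0 : ℝ) h1
  refine h2.congr_of_eventuallyEq (Eventually.of_forall fun t => ?_)
  simp

/-- To first order, a curve of coherent states through an eigenvector of positive eigenvalue of
`v · L` stays in the range of the positive spectral projection of a moving `v · L`. -/
theorem isBigO_sub_positiveSpectralProj {N : ℕ} (hN : 0 < N) {z : ℝ → Spinor} {n : UnitVec}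
    {v : ℝ → Fin 3 → ℝ} {c : ℝ} (hc : 0 < c)
    (hz : ∀ A, DifferentiableAt ℝ (fun t => z t A) 0)
    (hv : ∀ i, DifferentiableAt ℝ (fun t => v t i) 0)
    (hn : IsCoherentSpinor n (z 0)) (hv0 : ∀ i, v 0 i = c * (n : R3) i) :
    (fun t => coherent N (z t) - positiveSpectralProj (V := SymSpinor N) (dotL N (v t))
      (coherent N (z t))) =O[𝓝 0] (fun t : ℝ => t) := by
  set r : ℝ := c * (N / 2) with hr
  have hN' : (0 : ℝ) < N := by exact_mod_cast hN
  have hrpos : 0 < r := by positivity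
  have hcd := differentiableAt_coherent N hz
  have hd : DifferentiableAt ℝ
      (fun t => dotL N (v t) (coherent N (z t)) - (r : ℂ) • coherent N (z t)) 0 := by
    refine DifferentiableAt.sub ?_ (hcd.const_smul (r : ℂ))
    simp only [dotL_apply]
    refine DifferentiableAt.fun_sum fun i _ => ?_
    have hL : DifferentiableAt ℝ (fun t => Lgen N i (coherent N (z t))) 0 :=
      ((LinearMap.toContinuousLinearMap (𝕜 := ℂ) (E := SymSpinor N) (F' := SymSpinor N)
        (Lgen N i)).restrictScalars ℝ).differentiableAt.comp (0 : ℝ) hcd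
    simp only [Complex.coe_smul]
    exact (hv i).smul hL
  -- At `t = 0` the state is an exact eigenvector with eigenvalue `r`, so this differentiable
  -- residual is `O(t)`.
  have hO := hd.isBigO_sub
  have h0 : dotL N (v 0) (coherent N (z 0)) - (r : ℂ) • coherent N (z 0) = 0 := by
    have : v 0 = fun i => c * (n : R3) i := funext hv0
    rw [this, dotL_coherent N c hn, sub_self]
  simp only [h0, sub_zero] at hO
  refine Asymptotics.IsBigO.trans ?_ hO
  refine Asymptotics.IsBigO.of_bound r⁻¹ (Eventually.of_forall fun t => ?_)
  have := norm_sub_positiveSpectralProj_le (dotL_isSymmetric N (v t)) (coherent N (z t)) hrpos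
  rw [inv_mul_eq_div, le_div_iff₀ hrpos, mul_comm]
  exact this

/-- Both defects `(1 - P)z` and `(1 - P)ν` are `O(t)`, so the projector changes the inner product
only at order `t²`. -/
theorem hasDerivAt_inner_positiveSpectralProj {N : ℕ} (hN : 0 < N) {z : ℝ → Spinor} {z' ν : Spinor}
    {n : UnitVec} {v : ℝ → Fin 3 → ℝ} {c : ℝ} (hc : 0 < c)
    (hz : ∀ A, HasDerivAt (fun t => z t A) (z' A) 0) (horth : (inner ℂ (z 0) z' : ℂ) = 0)
    (hv : ∀ i, DifferentiableAt ℝ (fun t => v t i) 0)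
    (hn : IsCoherentSpinor n (z 0)) (hν : IsCoherentSpinor n ν)
    (hv0 : ∀ i, v 0 i = c * (n : R3) i) :
    HasDerivAt (fun t => (inner ℂ (coherent N (z t)) (positiveSpectralProj (V := SymSpinor N)
      (dotL N (v t)) (coherent N ν)) : ℂ)) 0 0 := by
  have h1 := isBigO_sub_positiveSpectralProj hN hc (fun A => (hz A).differentiableAt) hv hn hv0
  have h2 := isBigO_sub_positiveSpectralProj (z := fun _ => ν) hN hc
    (fun A => differentiableAt_const _) hv hν hv0
  have h3 : HasDerivAt (fun t => (inner ℂ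
      (coherent N (z t) - positiveSpectralProj (V := SymSpinor N) (dotL N (v t)) (coherent N (z t)))
      (coherent N ν - positiveSpectralProj (V := SymSpinor N) (dotL N (v t)) (coherent N ν)) : ℂ))
      0 0 := by
    have h4 : (fun t => (inner ℂ
        (coherent N (z t) - positiveSpectralProj (V := SymSpinor N) (dotL N (v t))
          (coherent N (z t)))
        (coherent N ν - positiveSpectralProj (V := SymSpinor N) (dotL N (v t)) (coherent N ν)) :
          ℂ)) =O[𝓝 0] (fun t : ℝ => ‖t - 0‖ ^ 2) := by
      have h5 := h1.norm_left.mul h2.norm_left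
      refine (Asymptotics.IsBigO.of_bound 1 (Eventually.of_forall fun t => ?_)).trans
        (h5.trans (Asymptotics.IsBigO.of_bound 1 (Eventually.of_forall fun t => ?_)))
      · rw [one_mul, norm_mul, norm_norm, norm_norm]
        exact norm_inner_le_norm (𝕜 := ℂ) (E := SymSpinor N) _ _
      · simp [sq]
    simpa using (h4.hasFDerivAt (𝕜 := ℝ) one_lt_two).hasDerivAt
  obtain ⟨k, -, hk⟩ := hn.exists_phase hν
  have h6 := ((hasDerivAt_inner_const hz horth hk).pow N).sub h3
  simp only [mul_zero, sub_zero] at h6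
  refine h6.congr_of_eventuallyEq (Eventually.of_forall fun t => ?_)
  simp only [inner_positiveSpectralProj, inner_coherent]
  rfl

/-! ### Regularity of the axis and local constancy of `β` -/

/-- The entries of a curve of matrices are differentiable at `0`. -/
def DiffEntries (M : ℝ → Matrix (Fin 2) (Fin 2) ℂ) : Prop :=
  ∀ i j, DifferentiableAt ℝ (fun t => M t i j) 0

theorem DiffEntries.mul {M M' : ℝ → Matrix (Fin 2) (Fin 2) ℂ} (h : DiffEntries M)
    (h' : DiffEntries M') : DiffEntries fun t => M t * M' t := by
  intro i j
  simp only [Matrix.mul_apply, Fin.sum_univ_two]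
  exact ((h i 0).mul (h' 0 j)).add ((h i 1).mul (h' 1 j))

theorem diffEntries_const (M : Matrix (Fin 2) (Fin 2) ℂ) : DiffEntries fun _ => M :=
  fun _ _ => differentiableAt_const _

theorem DiffEntries.inv {X : ℝ → SU2} (h : DiffEntries fun t => (X t).1) :
    DiffEntries fun t => ((X t)⁻¹ : SU2).1 := by
  intro i j
  exact (hasDerivAt_conj (h j i).hasDerivAt).differentiableAt

theorem DiffEntries.trace_re {M : ℝ → Matrix (Fin 2) (Fin 2) ℂ} (h : DiffEntries M) :
    DifferentiableAt ℝ (fun t => (Matrix.trace (M t)).re) 0 := by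
  simp only [Matrix.trace_fin_two]
  exact (Complex.reCLM.differentiableAt.comp (0 : ℝ) ((h 0 0).add (h 1 1)))

theorem diffEntries_Grel_fst {G : ℝ → Fin 5 → Spin4}
    (h : ∀ a, DiffEntries fun t => (G t a).1.1) (a b : Fin 5) :
    DiffEntries fun t => (Grel (G t) a b).1.1 :=
  (h a).inv.mul (h b)

theorem diffEntries_Grel_snd {G : ℝ → Fin 5 → Spin4}
    (h : ∀ a, DiffEntries fun t => (G t a).2.1) (a b : Fin 5) :
    DiffEntries fun t => (Grel (G t) a b).2.1 :=
  (h a).inv.mul (h b)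

theorem differentiableAt_trAxis {G : ℝ → Fin 5 → Spin4}
    (hm : ∀ a, DiffEntries fun t => (G t a).1.1) (hp : ∀ a, DiffEntries fun t => (G t a).2.1)
    (a b : Fin 5) (i : Fin 3) : DifferentiableAt ℝ (fun t => trAxis (G t) a b i) 0 :=
  (((diffEntries_const (tau i)).mul (diffEntries_Grel_fst hm a b)).mul
    (diffEntries_Grel_snd hp b a)).trace_re

theorem differentiableAt_det_fin_three {f : Fin 3 → Fin 3 → ℝ → ℝ} {x : ℝ}
    (h : ∀ r i, DifferentiableAt ℝ (f r i) x) :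
    DifferentiableAt ℝ (fun t => Matrix.det (Matrix.of fun r i => f r i t)) x := by
  simp only [Matrix.det_fin_three, Matrix.of_apply]
  fun_prop

theorem spin4Act_succ (G : Spin4) (V : Fin 4 → ℝ) (i : Fin 3) :
    spin4Act G V i.succ = (Matrix.trace (tau i * (G.1.1 * zeta V * (G.2⁻¹ : SU2).1))).re :=
  rfl

theorem differentiableAt_tripleProd {G : ℝ → Fin 5 → Spin4}
    (hm : ∀ a, DiffEntries fun t => (G t a).1.1) (hp : ∀ a, DiffEntries fun t => (G t a).2.1)
    (a b : Fin 5) : DifferentiableAt ℝ (fun t => tripleProd (G t) a b) 0 := by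
  refine differentiableAt_det_fin_three
    (f := fun r i t => spin4Act (Grel (G t) a (others a b r)) refVec i.succ) fun r i => ?_
  simp only [spin4Act_succ]
  exact ((diffEntries_const (tau i)).mul (((diffEntries_Grel_fst hm a _).mul
    (diffEntries_const (zeta refVec))).mul (diffEntries_Grel_snd hp a _).inv)).trace_re

/-- `β ≠ 0` keeps the product of triple products away from zero, where its sign is locally constant.
-/
theorem eventually_beta_eq {G : ℝ → Fin 5 → Spin4}
    (hm : ∀ a, DiffEntries fun t => (G t a).1.1) (hp : ∀ a, DiffEntries fun t => (G t a).2.1)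
    (a b : Fin 5) (h0 : beta (G 0) a b ≠ 0) : ∀ᶠ t in 𝓝 0, beta (G t) a b = beta (G 0) a b := by
  have hc : ContinuousAt (fun t => tripleProd (G t) a b * tripleProd (G t) b a) 0 :=
    ((differentiableAt_tripleProd hm hp a b).mul
      (differentiableAt_tripleProd hm hp b a)).continuousAt
  have hne : tripleProd (G 0) a b * tripleProd (G 0) b a ≠ 0 := by
    intro h
    apply h0
    rw [beta, h, Real.sign_zero, neg_zero]
  rcases lt_or_gt_of_ne hne with h | h
  · filter_upwards [hc.eventually (gt_mem_nhds h)] with t ht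
    rw [beta, beta, Real.sign_of_neg ht, Real.sign_of_neg h]
  · filter_upwards [hc.eventually (lt_mem_nhds h)] with t ht
    rw [beta, beta, Real.sign_of_pos ht, Real.sign_of_pos h]

/-! ### The axis of `X⁻_ba X⁺_ab` at an oriented configuration -/

theorem SU2_inv_mul (X : SU2) : (X⁻¹ : SU2).1 * X.1 = 1 := by
  rw [← Submonoid.coe_mul, inv_mul_cancel]; rfl

theorem intertwine_of_conj {R : Type*} [Ring R] {A A' B B' S T : R} (hA : A' * A = 1)
    (hB : B' * B = 1) (h : A * S * A' = -(B * T * B')) : A' * B * T = -(S * (A' * B)) := by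
  have h1 : A' * (B * T * B') * B = A' * B * T := by
    simp only [mul_assoc]
    rw [hB, mul_one]
  have h2 : A' * (A * S * A') * B = S * (A' * B) := by
    simp only [← mul_assoc]
    rw [hA, one_mul]
  rw [← h1, ← h2, h]
  noncomm_ring

theorem su2_intertwine {X Y : SU2} {n m : R3} (h : adjoint X n = -adjoint Y m) :
    (X⁻¹ * Y : SU2).1 * su2 m = -(su2 n * (X⁻¹ * Y : SU2).1) :=
  intertwine_of_conj (SU2_inv_mul X) (SU2_inv_mul Y) h

/-- The numbers `tr(τ_i W)` are, up to a common factor, the `su(2)` components of `W`; commuting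
with `su2 n` says that their cross product with `n` vanishes. -/
theorem axis_parallel_of_commute {W : SU2} {n : R3} (h : W.1 * su2 n = su2 n * W.1) (i j : Fin 3) :
    (Matrix.trace (tau i * W.1)).re * n j = (Matrix.trace (tau j * W.1)).re * n i := by
  obtain ⟨e1, e2⟩ := SU2_entries W
  have t0 : (Matrix.trace (tau 0 * W.1)).re = (W.1 0 1).im := by
    rw [Matrix.trace_fin_two, Matrix.mul_apply, Matrix.mul_apply, Fin.sum_univ_two,
      Fin.sum_univ_two, e2]
    simp [tau, pauli]
    ring
  have t1 : (Matrix.trace (tau 1 * W.1)).re = (W.1 0 1).re := by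
    rw [Matrix.trace_fin_two, Matrix.mul_apply, Matrix.mul_apply, Fin.sum_univ_two,
      Fin.sum_univ_two, e2]
    simp [tau, pauli]
    ring
  have t2 : (Matrix.trace (tau 2 * W.1)).re = (W.1 0 0).im := by
    rw [Matrix.trace_fin_two, Matrix.mul_apply, Matrix.mul_apply, Fin.sum_univ_two,
      Fin.sum_univ_two, e1]
    simp [tau, pauli]
    ring
  rw [su2_eq] at h
  have h00 := congrArg Complex.re (congrFun (congrFun h 0) 0)
  have h00' := congrArg Complex.im (congrFun (congrFun h 0) 0)
  have h01 := congrArg Complex.re (congrFun (congrFun h 0) 1)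
  have h01' := congrArg Complex.im (congrFun (congrFun h 0) 1)
  simp [Matrix.mul_apply, Fin.sum_univ_two, e1, e2] at h00 h00' h01 h01'
  fin_cases i <;> fin_cases j <;> simp only [Fin.zero_eta, Fin.mk_one, Fin.reduceFinMk, t0, t1, t2] <;>
    linarith

/-- At a configuration with the right orientation the axis of `X⁻_ba X⁺_ab` is along `n_ba`. -/
theorem trAxis_eq {G : Fin 5 → Spin4} {a b : Fin 5} {n : R3} {m : UnitVec}
    (hm : adjoint (G a).1 n = -adjoint (G b).1 m) (hp : adjoint (G a).2 n = -adjoint (G b).2 m)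
    (i : Fin 3) : trAxis G b a i = (∑ j, trAxis G b a j * (m : R3) j) * (m : R3) i := by
  have hm' : adjoint (G b).1 (m : R3) = -adjoint (G a).1 n := by rw [hm, neg_neg]
  have c1 := su2_intertwine hm'
  have c2 := su2_intertwine hp
  have hc : (((G b).1⁻¹ * (G a).1) * ((G a).2⁻¹ * (G b).2) : SU2).1 * su2 (m : R3) =
      su2 (m : R3) * (((G b).1⁻¹ * (G a).1) * ((G a).2⁻¹ * (G b).2) : SU2).1 := by
    -- Each sector reverses the sign once, so the product of the two commutes with `su2 m`.
    rw [Submonoid.coe_mul, mul_assoc, c2, mul_neg, ← mul_assoc, c1, neg_mul, neg_neg, mul_assoc]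
  have hpar := axis_parallel_of_commute hc
  have ht : ∀ i, trAxis G b a i = (Matrix.trace (tau i *
      (((G b).1⁻¹ * (G a).1) * ((G a).2⁻¹ * (G b).2) : SU2).1)).re := by
    intro i
    rw [Submonoid.coe_mul, ← mul_assoc]
    rfl
  simp only [← ht] at hpar
  have hs := m.sq_sum
  have p0 := hpar i 0
  have p1 := hpar i 1
  have p2 := hpar i 2
  rw [Fin.sum_univ_three]
  linear_combination (-trAxis G b a i) * hs + (m : R3) 0 * p0 + (m : R3) 1 * p1 + (m : R3) 2 * p2

theorem su2_smul_single (i : Fin 3) (k : ℝ) :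
    su2 (k • EuclideanSpace.single i (1 : ℝ)) = (k : ℂ) • tau i := by
  rw [su2, Finset.sum_eq_single i]
  · simp
  · intro j _ hj
    simp [hj]
  · simp

theorem expTau_zero (i : Fin 3) : expTau i 0 = 1 := by
  apply Subtype.ext
  simp [expTau]

theorem hasDerivAt_expTau (X : SU2) (i : Fin 3) (k : ℝ) (A B : Fin 2) :
    HasDerivAt (fun t => (X * expTau i (k * t) : SU2).1 A B)
      ((X.1 * su2 (k • EuclideanSpace.single i (1 : ℝ))) A B) 0 := by
  have h0 : HasDerivAt (fun t : ℝ => k * t / 2) (k / 2) 0 := by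
    simpa using ((hasDerivAt_id (0 : ℝ)).const_mul k).div_const 2
  have hc : HasDerivAt (fun t : ℝ => ((Real.cos (k * t / 2) : ℝ) : ℂ)) ((0 : ℝ) : ℂ) 0 := by
    have := h0.cos.ofReal_comp
    simpa using this
  have hs : HasDerivAt (fun t : ℝ => ((2 * Real.sin (k * t / 2) : ℝ) : ℂ)) ((k : ℝ) : ℂ) 0 := by
    have := (h0.sin.const_mul 2).ofReal_comp
    have e : 2 * (Real.cos (k * 0 / 2) * (k / 2)) = k := by simp; ring
    rwa [e] at this
  have h := (hc.mul_const (X.1 A B)).add (hs.mul_const ((X.1 * tau i) A B))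
  have e : (X.1 * su2 (k • EuclideanSpace.single i (1 : ℝ))) A B =
      ((0 : ℝ) : ℂ) * X.1 A B + (k : ℂ) * (X.1 * tau i) A B := by
    rw [su2_smul_single, Matrix.mul_smul]
    simp
  rw [e]
  refine h.congr_of_eventuallyEq (Eventually.of_forall fun t => ?_)
  simp only [expTau, Submonoid.coe_mul, mul_add, Matrix.mul_smul, mul_one, Matrix.add_apply,
    Matrix.smul_apply, smul_eq_mul, Pi.add_apply]

/-! ### Face factors: phases, bounds and equality cases -/

/-- A face factor of `exp(S)`, in terms of spin-1/2 spinors. -/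
def spinorFace (N p q : ℕ) (P : SymSpinor N →L[ℂ] SymSpinor N) (Xa Xb : Spin4)
    (z z' ν ν' : Spinor) : ℂ :=
  inner ℂ z ν ^ N * eps2 (act Xa.2.1 z) (act Xb.2.1 z') ^ p *
    inner ℂ (coherent N z') (P (coherent N ν')) *
    (starRingEnd ℂ) (eps2 (act Xa.1.1 z) (act Xb.1.1 z') ^ q)

theorem faceFactor_eq {γ : ℝ} (D : BoundaryData γ) (ν : Fin 5 → Fin 5 → Spinor)
    (w : UnitVec → Spinor) (x : Config) (a b : Fin 5) :
    faceFactor D ν w x a b = spinorFace (D.twoK a b) (twoSPlus γ (D.twoK a b))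
      (twoSMinus γ (D.twoK a b)) (Pproj (D.twoK a b) x.1 b a) (x.1 a) (x.1 b)
      (w (x.2 a b)) (w (x.2 b a)) (ν a b) (ν b a) := by
  simp only [faceFactor, spinorFace, rho_coherent, inner_Jmap_coherent, inner_coherent]
  rw [← eps2_act_rel, ← eps2_act_rel]
  rfl

theorem act_smul (X : Matrix (Fin 2) (Fin 2) ℂ) (c : ℂ) (z : Spinor) :
    act X (c • z) = c • act X z := by
  ext A
  simp [act]
  ring

theorem eps2_smul_smul (c c' : ℂ) (u v : Spinor) : eps2 (c • u) (c' • v) = c * c' * eps2 u v := by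
  simp [eps2]
  ring

/-- The phases of the coherent states `|m⟩` drop out of the face factors. -/
theorem spinorFace_smul {N p q : ℕ} (hpq : p = q + N) (P : SymSpinor N →L[ℂ] SymSpinor N)
    (Xa Xb : Spin4) (z z' ν ν' : Spinor) {c c' : ℂ} (hc : ‖c‖ = 1) (hc' : ‖c'‖ = 1) :
    spinorFace N p q P Xa Xb (c • z) (c' • z') ν ν' = spinorFace N p q P Xa Xb z z' ν ν' := by
  have h : c * (starRingEnd ℂ) c = 1 := by rw [Complex.mul_conj', hc]; simp
  have h' : c' * (starRingEnd ℂ) c' = 1 := by rw [Complex.mul_conj', hc']; simp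
  subst hpq
  simp only [spinorFace, act_smul, eps2_smul_smul, coherent_smul, SymSpinor.inner_smul_left,
    _root_.inner_smul_left, mul_pow, map_mul, map_pow]
  generalize eps2 (act Xa.2.1 z) (act Xb.2.1 z') = e
  generalize (starRingEnd ℂ) (eps2 (act Xa.1.1 z) (act Xb.1.1 z')) = e'
  generalize (inner ℂ (coherent N z') (P (coherent N ν')) : ℂ) = i
  have hN : c ^ N * (starRingEnd ℂ) c ^ N = 1 := by rw [← mul_pow, h, one_pow]
  have hN' : c' ^ N * (starRingEnd ℂ) c' ^ N = 1 := by rw [← mul_pow, h', one_pow]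
  have hq : c ^ q * (starRingEnd ℂ) c ^ q = 1 := by rw [← mul_pow, h, one_pow]
  have hq' : c' ^ q * (starRingEnd ℂ) c' ^ q = 1 := by rw [← mul_pow, h', one_pow]
  -- Each phase occurs `p = q + N` times directly and `q + N` times conjugated.
  calc _ = (c ^ N * (starRingEnd ℂ) c ^ N) * (c' ^ N * (starRingEnd ℂ) c' ^ N) *
        (c ^ q * (starRingEnd ℂ) c ^ q) * (c' ^ q * (starRingEnd ℂ) c' ^ q) *
        (inner ℂ z ν ^ N * e ^ (q + N) * i * e' ^ q) := by ring
    _ = _ := by rw [hN, hN', hq, hq']; ring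

/-- This lets an arbitrary, possibly discontinuous, choice of `|m⟩` be replaced by a differentiable
lift. -/
theorem spinorFace_congr {N p q : ℕ} (hpq : p = q + N) (P : SymSpinor N →L[ℂ] SymSpinor N)
    (Xa Xb : Spin4) {n n' : UnitVec} {z z' y y' : Spinor} (ν ν' : Spinor)
    (hz : IsCoherentSpinor n z) (hy : IsCoherentSpinor n y)
    (hz' : IsCoherentSpinor n' z') (hy' : IsCoherentSpinor n' y') :
    spinorFace N p q P Xa Xb z z' ν ν' = spinorFace N p q P Xa Xb y y' ν ν' := by
  obtain ⟨c, hc, rfl⟩ := hy.exists_phase hz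
  obtain ⟨c', hc', rfl⟩ := hy'.exists_phase hz'
  exact spinorFace_smul hpq P Xa Xb y y' ν ν' hc hc'

section Spins

variable {γ : ℝ}

theorem BoundaryData.twoSPlus_eq (D : BoundaryData γ) (hγ : 1 < γ) {a b : Fin 5} (hab : a ≠ b) :
    (twoSPlus γ (D.twoK a b) : ℝ) = (1 + γ) * D.twoK a b / 2 := by
  obtain ⟨⟨p, hp⟩, -⟩ := D.mem a b hab
  rw [twoSPlus, ← hp, Nat.floor_natCast, hp, abs_of_pos (by linarith)]

theorem BoundaryData.twoSMinus_eq (D : BoundaryData γ) (hγ : 1 < γ) {a b : Fin 5} (hab : a ≠ b) :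
    (twoSMinus γ (D.twoK a b) : ℝ) = (γ - 1) * D.twoK a b / 2 := by
  obtain ⟨-, ⟨q, hq⟩⟩ := D.mem a b hab
  rw [twoSMinus, ← hq, Nat.floor_natCast, hq, abs_of_neg (by linarith), neg_sub]

theorem BoundaryData.twoSPlus_eq_add (D : BoundaryData γ) (hγ : 1 < γ) {a b : Fin 5}
    (hab : a ≠ b) : twoSPlus γ (D.twoK a b) = twoSMinus γ (D.twoK a b) + D.twoK a b := by
  have h1 := D.twoSPlus_eq hγ hab
  have h2 := D.twoSMinus_eq hγ hab
  have : (twoSPlus γ (D.twoK a b) : ℝ) = twoSMinus γ (D.twoK a b) + D.twoK a b := by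
    rw [h1, h2]; ring
  exact_mod_cast this

/-- With a zero exponent the `X⁻` factor would be trivially 1 and would impose no orientation
condition. -/
theorem BoundaryData.twoSMinus_ne_zero (D : BoundaryData γ) (hγ : 1 < γ) {a b : Fin 5}
    (hab : a ≠ b) : twoSMinus γ (D.twoK a b) ≠ 0 := by
  have h2 := D.twoSMinus_eq hγ hab
  have h3 : (0 : ℝ) < D.twoK a b := by exact_mod_cast D.pos a b hab
  intro h
  rw [h] at h2
  push_cast at h2
  nlinarith

end Spins

theorem four_factors_of_one_le {a b c d : ℝ} (ha : 0 ≤ a) (hb : 0 ≤ b) (hc : 0 ≤ c) (hd : 0 ≤ d)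
    (ha1 : a ≤ 1) (hb1 : b ≤ 1) (hc1 : c ≤ 1) (hd1 : d ≤ 1) (h : 1 ≤ a * b * c * d) :
    a = 1 ∧ b = 1 ∧ c = 1 ∧ d = 1 := by
  have hab : a * b ≤ 1 := mul_le_one₀ ha1 hb hb1
  have habc : a * b * c ≤ 1 := mul_le_one₀ hab hc hc1
  have h0 : 0 ≤ a * b := mul_nonneg ha hb
  have h1 : 1 ≤ a * b * c := by nlinarith [mul_nonneg h0 hc]
  have h2 : 1 ≤ a * b := by nlinarith
  have h3 : 1 ≤ a := by nlinarith
  refine ⟨le_antisymm ha1 h3, ?_, ?_, ?_⟩ <;> nlinarith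

theorem norm_spinorFace_le {N p q : ℕ} {T : SymSpinor N →ₗ[ℂ] SymSpinor N}
    {Xa Xb : Spin4} {n n' l l' : UnitVec} {z z' ν ν' : Spinor}
    (hz : IsCoherentSpinor n z) (hz' : IsCoherentSpinor n' z')
    (hν : IsCoherentSpinor l ν) (hν' : IsCoherentSpinor l' ν') :
    ‖spinorFace N p q (positiveSpectralProj (V := SymSpinor N) T) Xa Xb z z' ν ν'‖ ≤ 1 ∧
    (1 ≤ ‖spinorFace N p q (positiveSpectralProj (V := SymSpinor N) T) Xa Xb z z' ν ν'‖ →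
      ‖(inner ℂ z ν : ℂ)‖ ^ N = 1 ∧ ‖eps2 (act Xa.2.1 z) (act Xb.2.1 z')‖ ^ p = 1 ∧
      ‖(inner ℂ (coherent N z') (positiveSpectralProj (V := SymSpinor N) T (coherent N ν')) : ℂ)‖ = 1
      ∧ ‖eps2 (act Xa.1.1 z) (act Xb.1.1 z')‖ ^ q = 1) := by
  have h1 : ‖(inner ℂ z ν : ℂ)‖ ^ N ≤ 1 := by
    refine pow_le_one₀ (norm_nonneg _) ?_
    have := norm_inner_le_norm (𝕜 := ℂ) z ν
    rwa [hz.1, hν.1, mul_one] at this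
  have h2 : ‖eps2 (act Xa.2.1 z) (act Xb.2.1 z')‖ ^ p ≤ 1 :=
    pow_le_one₀ (norm_nonneg _) (norm_eps2_le (by rw [norm_act, hz.1]) (by rw [norm_act, hz'.1]))
  have h3 : ‖eps2 (act Xa.1.1 z) (act Xb.1.1 z')‖ ^ q ≤ 1 :=
    pow_le_one₀ (norm_nonneg _) (norm_eps2_le (by rw [norm_act, hz.1]) (by rw [norm_act, hz'.1]))
  have h4 : ‖(inner ℂ (coherent N z')
      (positiveSpectralProj (V := SymSpinor N) T (coherent N ν')) : ℂ)‖ ≤ 1 := by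
    have e1 := norm_inner_le_norm (𝕜 := ℂ) (E := SymSpinor N) (coherent N z')
      (positiveSpectralProj (V := SymSpinor N) T (coherent N ν'))
    have e2 := norm_positiveSpectralProj_le (V := SymSpinor N) T (coherent N ν')
    rw [(coherent_spec N _ _ hz').1, one_mul] at e1
    rw [(coherent_spec N _ _ hν').1] at e2
    exact e1.trans e2
  rw [spinorFace, norm_mul, norm_mul, norm_mul, norm_pow, norm_pow, RCLike.norm_conj, norm_pow]
  have k1 := pow_nonneg (norm_nonneg (inner ℂ z ν : ℂ)) N
  have k2 := pow_nonneg (norm_nonneg (eps2 (act Xa.2.1 z) (act Xb.2.1 z'))) p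
  have k3 := pow_nonneg (norm_nonneg (eps2 (act Xa.1.1 z) (act Xb.1.1 z'))) q
  have k4 := norm_nonneg (inner ℂ (coherent N z')
    (positiveSpectralProj (V := SymSpinor N) T (coherent N ν')) : ℂ)
  exact ⟨mul_le_one₀ (mul_le_one₀ (mul_le_one₀ h1 k2 h2) k4 h4) k3 h3,
    four_factors_of_one_le k1 k2 k4 k3 h1 h2 h4 h3⟩

/-- The operator defining `P_ba` is thus a multiple of `n_ba · L`, of which `|n_ba⟩` is an
eigenvector. -/
theorem beta_axis {G : Fin 5 → Spin4} {a b : Fin 5} {n : R3} {m : UnitVec}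
    (hm : adjoint (G a).1 n = -adjoint (G b).1 m) (hp : adjoint (G a).2 n = -adjoint (G b).2 m) :
    (fun i => beta G a b * trAxis G b a i) =
      fun i => (beta G a b * ∑ j, trAxis G b a j * (m : R3) j) * (m : R3) i := by
  funext i
  rw [trAxis_eq hm hp i]
  ring

/-- Where a face factor has modulus one, the vectors `m` agree with the boundary data and the
orientation conditions hold. -/
theorem conditions_of_one_le_norm_face {N p q : ℕ} (hN : N ≠ 0) (hp : p ≠ 0) (hq : q ≠ 0)
    {G : Fin 5 → Spin4} {a b : Fin 5} {n n' l l' : UnitVec} {z z' ν ν' : Spinor}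
    (hz : IsCoherentSpinor n z) (hz' : IsCoherentSpinor n' z')
    (hν : IsCoherentSpinor l ν) (hν' : IsCoherentSpinor l' ν')
    (h : 1 ≤ ‖spinorFace N p q (Pproj N G b a) (G a) (G b) z z' ν ν'‖) :
    n = l ∧ n' = l' ∧ adjoint (G a).1 l = -adjoint (G b).1 l' ∧
      adjoint (G a).2 l = -adjoint (G b).2 l' ∧
      0 < beta G a b * ∑ i, trAxis G b a i * (l' : R3) i := by
  obtain ⟨h1, h2, h3, h4⟩ := (norm_spinorFace_le hz hz' hν hν').2 h
  rw [pow_eq_one_iff_of_nonneg (norm_nonneg _) (by assumption)] at h1 h2 h4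
  have e1 : n = l := hz.eq_of_norm_inner hν h1
  -- Cauchy-Schwarz gives `1 ≤ ‖Pν'‖`, and a projection that preserves the norm of a vector fixes
  -- it.
  have hPν : positiveSpectralProj (V := SymSpinor N) (dotL N fun i => beta G a b * trAxis G b a i)
      (coherent N ν') = coherent N ν' := by
    refine positiveSpectralProj_eq_self_of_norm ?_
    have e := norm_inner_le_norm (𝕜 := ℂ) (E := SymSpinor N) (coherent N z')
      (positiveSpectralProj (V := SymSpinor N) (dotL N fun i => beta G a b * trAxis G b a i)
        (coherent N ν'))
    rw [(coherent_spec N _ _ hz').1, one_mul, h3] at e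
    rwa [(coherent_spec N _ _ hν').1]
  have e2 : n' = l' := by
    rw [hPν, inner_coherent, norm_pow, pow_eq_one_iff_of_nonneg (norm_nonneg _) hN] at h3
    exact hz'.eq_of_norm_inner hν' h3
  subst e1 e2
  have o1 := (hz.norm_eps2_act_iff hz' (G a).1 (G b).1).1 h4
  have o2 := (hz.norm_eps2_act_iff hz' (G a).2 (G b).2).1 h2
  refine ⟨rfl, rfl, o1, o2, ?_⟩
  -- With a nonpositive eigenvalue `P` would annihilate the unit vector that it fixes.
  by_contra hneg
  push Not at hneg
  rw [beta_axis o1 o2] at hPν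
  have h0 := positiveSpectralProj_of_nonpos (dotL_isSymmetric N _)
    (mul_nonpos_of_nonpos_of_nonneg hneg (by positivity)) (dotL_coherent N _ hν')
  rw [h0] at hPν
  have hn := (coherent_spec N _ _ hν').1
  rw [← hPν] at hn
  simp at hn

/-- The boundary conditions for a single face. -/
structure FaceConditions (G : Fin 5 → Spin4) (a b : Fin 5) (l l' : UnitVec) : Prop where
  minus : adjoint (G a).1 l = -adjoint (G b).1 l'
  plus : adjoint (G a).2 l = -adjoint (G b).2 l'
  proper : 0 < beta G a b * ∑ i, trAxis G b a i * (l' : R3) i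

theorem FaceConditions.norm_face {N p q : ℕ} (hN : 0 < N) {G : Fin 5 → Spin4} {a b : Fin 5}
    {l l' : UnitVec} {z z' ν ν' : Spinor} (h : FaceConditions G a b l l')
    (hz : IsCoherentSpinor l z) (hz' : IsCoherentSpinor l' z')
    (hν : IsCoherentSpinor l ν) (hν' : IsCoherentSpinor l' ν') :
    ‖spinorFace N p q (Pproj N G b a) (G a) (G b) z z' ν ν'‖ = 1 := by
  have hN' : (0 : ℝ) < N := by exact_mod_cast hN
  have h1 := hz.norm_inner hν
  have h2 := (hz.norm_eps2_act_iff hz' (G a).1 (G b).1).2 h.minus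
  have h3 := (hz.norm_eps2_act_iff hz' (G a).2 (G b).2).2 h.plus
  have hPν : Pproj N G b a (coherent N ν') = coherent N ν' := by
    rw [Pproj, beta_axis h.minus h.plus]
    exact positiveSpectralProj_of_pos (mul_pos h.proper (by positivity)) (dotL_coherent N _ hν')
  rw [spinorFace, norm_mul, norm_mul, norm_mul, norm_pow, norm_pow, RCLike.norm_conj, norm_pow, hPν,
    inner_coherent, norm_pow, h1, h2, h3, hz'.norm_inner hν']
  simp

/-! ### Logarithmic derivative of the action -/

theorem hasDerivAt_log_mul {f g : ℝ → ℂ} {k l : ℂ} (hf : HasDerivAt f (f 0 * k) 0)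
    (hg : HasDerivAt g (g 0 * l) 0) :
    HasDerivAt (fun t => f t * g t) (f 0 * g 0 * (k + l)) 0 := by
  have h := hf.mul hg
  have e : f 0 * k * g 0 + f 0 * (g 0 * l) = f 0 * g 0 * (k + l) := by ring
  rwa [e] at h

theorem hasDerivAt_log_pow {f : ℝ → ℂ} {k : ℂ} (hf : HasDerivAt f (f 0 * k) 0) (n : ℕ) :
    HasDerivAt (fun t => f t ^ n) (f 0 ^ n * (n * k)) 0 := by
  induction n with
  | zero => simpa using hasDerivAt_const (0 : ℝ) (1 : ℂ)
  | succ n ih =>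
    have h := hasDerivAt_log_mul ih hf
    simp only [← pow_succ] at h
    convert h using 2
    push_cast
    ring

theorem hasDerivAt_log_prod {ι : Type*} (s : Finset ι) {f : ι → ℝ → ℂ} {k : ι → ℂ}
    (hf : ∀ i ∈ s, HasDerivAt (f i) (f i 0 * k i) 0) :
    HasDerivAt (fun t => ∏ i ∈ s, f i t) ((∏ i ∈ s, f i 0) * ∑ i ∈ s, k i) 0 := by
  classical
  induction s using Finset.induction_on with
  | empty => simpa using hasDerivAt_const (0 : ℝ) (1 : ℂ)
  | insert i s hi ih =>
    have h := hasDerivAt_log_mul (hf i (Finset.mem_insert_self i s))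
      (ih fun j hj => hf j (Finset.mem_insert_of_mem hj))
    simp only [Finset.prod_insert hi, Finset.sum_insert hi]
    exact h

/-- Only the two `ε` factors contribute. Their logarithmic derivatives are imaginary, so the
conjugation in the `X⁻` factor gives the minus sign. -/
theorem FaceConditions.hasDerivAt_face {N p q : ℕ} (hN : 0 < N) (hpq : p = q + N)
    {G : ℝ → Fin 5 → Spin4} {ξm ξp : Fin 5 → R3} {m m' : ℝ → UnitVec} {a b : Fin 5}
    {w : UnitVec → Spinor} {ν ν' : Spinor} (h : FaceConditions (G 0) a b (m 0) (m' 0))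
    (hw : ∀ v, IsCoherentSpinor v (w v))
    (hν : IsCoherentSpinor (m 0) ν) (hν' : IsCoherentSpinor (m' 0) ν')
    (hGm : ∀ a i j, HasDerivAt (fun t => (G t a).1.1 i j) (((G 0 a).1.1 * su2 (ξm a)) i j) 0)
    (hGp : ∀ a i j, HasDerivAt (fun t => (G t a).2.1 i j) (((G 0 a).2.1 * su2 (ξp a)) i j) 0)
    (hm : DifferentiableAt ℝ (fun t => (m t : R3)) 0)
    (hm' : DifferentiableAt ℝ (fun t => (m' t : R3)) 0) :
    HasDerivAt (fun t => spinorFace N p q (Pproj N (G t) b a) (G t a) (G t b)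
        (w (m t)) (w (m' t)) ν ν')
      (spinorFace N p q (Pproj N (G 0) b a) (G 0 a) (G 0 b) (w (m 0)) (w (m' 0)) ν ν' *
        (-(Complex.I / 2) * (p * ((inner ℝ (ξp a) (m 0 : R3) + inner ℝ (ξp b) (m' 0 : R3) : ℝ) : ℂ)
          - q * ((inner ℝ (ξm a) (m 0 : R3) + inner ℝ (ξm b) (m' 0 : R3) : ℝ) : ℂ)))) 0 := by
  obtain ⟨z, zd, hz, hz0, hzd, hzo⟩ := exists_horizontal_lift hm (hw (m 0))
  obtain ⟨y, yd, hy, hy0, hyd, hyo⟩ := exists_horizontal_lift hm' (hw (m' 0))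
  rw [← hz0] at hzo
  rw [← hy0] at hyo
  have cz : IsCoherentSpinor (m 0) (z 0) := by rw [hz0]; exact hw _
  have cy : IsCoherentSpinor (m' 0) (y 0) := by rw [hy0]; exact hw _
  obtain ⟨k, -, hk⟩ := cz.exists_phase hν
  have d1 : HasDerivAt (fun t => (inner ℂ (z t) ν : ℂ)) (inner ℂ (z 0) ν * 0) 0 := by
    rw [mul_zero]
    exact hasDerivAt_inner_const hzd hzo hk
  have d2 := hasDerivAt_eps2_act (hGp a) (hGp b) hzd hyd hzo hyo cz cy
    ((cz.norm_eps2_act_iff cy _ _).2 h.plus)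
  have d4 := hasDerivAt_eps2_act (hGm a) (hGm b) hzd hyd hzo hyo cz cy
    ((cz.norm_eps2_act_iff cy _ _).2 h.minus)
  have hDm : ∀ a, DiffEntries fun t => (G t a).1.1 := fun a i j => (hGm a i j).differentiableAt
  have hDp : ∀ a, DiffEntries fun t => (G t a).2.1 := fun a i j => (hGp a i j).differentiableAt
  have hb0 : beta (G 0) a b ≠ 0 := by
    intro h0
    have := h.proper
    rw [h0, zero_mul] at this
    exact lt_irrefl _ this
  have d3 : HasDerivAt (fun t => (inner ℂ (coherent N (y t)) (Pproj N (G t) b a (coherent N ν')) :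
      ℂ)) (inner ℂ (coherent N (y 0)) (Pproj N (G 0) b a (coherent N ν')) * 0) 0 := by
    rw [mul_zero]
    have hd := hasDerivAt_inner_positiveSpectralProj hN
      -- `β` is frozen at its value at `t = 0`, with which it agrees for small `t`.
      (v := fun t i => beta (G 0) a b * trAxis (G t) b a i) h.proper hyd hyo
      (fun i => (differentiableAt_trAxis hDm hDp b a i).const_mul _) cy hν'
      (fun i => congrFun (beta_axis h.minus h.plus) i)
    refine hd.congr_of_eventuallyEq ?_
    filter_upwards [eventually_beta_eq hDm hDp a b hb0] with t ht
    rw [Pproj, ht]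
  have d4' := hasDerivAt_conj (hasDerivAt_log_pow d4 q)
  rw [map_mul] at d4'
  have hd := hasDerivAt_log_mul (hasDerivAt_log_mul (hasDerivAt_log_mul (hasDerivAt_log_pow d1 N)
    (hasDerivAt_log_pow d2 p)) d3) d4'
  have hval : spinorFace N p q (Pproj N (G 0) b a) (G 0 a) (G 0 b) (w (m 0)) (w (m' 0)) ν ν' =
      spinorFace N p q (Pproj N (G 0) b a) (G 0 a) (G 0 b) (z 0) (y 0) ν ν' := by
    rw [hz0, hy0]
  rw [hval]
  have hd2 := hd.congr_of_eventuallyEq (f₁ := fun t => spinorFace N p q (Pproj N (G t) b a) (G t a)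
    (G t b) (w (m t)) (w (m' t)) ν ν') (by
      filter_upwards [hz, hy] with t ht ht'
      exact spinorFace_congr hpq _ _ _ ν ν' (hw _) ht (hw _) ht')
  have h2 : (starRingEnd ℂ) (2 : ℂ) = 2 := map_ofNat _ 2
  have e : ∀ r s : ℝ, -(Complex.I / 2) * (p * (r : ℂ) - q * (s : ℂ)) =
      N * 0 + p * (-(Complex.I / 2) * (r : ℂ)) + 0 +
        (starRingEnd ℂ) (q * (-(Complex.I / 2) * (s : ℂ))) := by
    intro r s
    simp only [map_mul, map_neg, map_div₀, h2, Complex.conj_I, Complex.conj_ofReal, map_natCast]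
    ring
  rw [e]
  exact hd2

/-- The closure vector `∑_{b ≠ a} k_ab n_ab`. -/
def closureVec {γ : ℝ} (D : BoundaryData γ) (a : Fin 5) : R3 :=
  ∑ b ∈ Finset.univ.filter (fun b => b ≠ a), ((D.twoK a b : ℝ) / 2) • (D.n a b : R3)

theorem sum_lt_add_swap (h : Fin 5 → Fin 5 → ℝ) :
    ∑ a : Fin 5, ∑ b ∈ Finset.univ.filter (fun b => a < b), (h a b + h b a) =
      ∑ a : Fin 5, ∑ b ∈ Finset.univ.filter (fun b => b ≠ a), h a b := by
  simp only [Finset.sum_filter, Fin.sum_univ_five]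
  simp only [Fin.reduceLT, Fin.isValue, ne_eq, Fin.reduceEq, not_true_eq_false, not_false_eq_true,
    if_true, if_false, lt_self_iff_false]
  ring

theorem expAction_eq {γ : ℝ} (D : BoundaryData γ) (ν : Fin 5 → Fin 5 → Spinor)
    (w : UnitVec → Spinor) (x : Config) :
    expAction D ν w x = ∏ a : Fin 5, ∏ b ∈ Finset.univ.filter (fun b => a < b),
      spinorFace (D.twoK a b) (twoSPlus γ (D.twoK a b)) (twoSMinus γ (D.twoK a b))
        (Pproj (D.twoK a b) x.1 b a) (x.1 a) (x.1 b) (w (x.2 a b)) (w (x.2 b a)) (ν a b)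
        (ν b a) := by
  simp only [expAction, faceFactor_eq]

/-- The logarithmic derivative of `exp(S)` at a configuration satisfying the orientation
conditions. -/
theorem hasDerivAt_expAction {γ : ℝ} (hγ : 1 < γ) (D : BoundaryData γ) {ν : Fin 5 → Fin 5 → Spinor}
    (hν : ∀ a b, a ≠ b → IsCoherentSpinor (D.n a b) (ν a b)) {w : UnitVec → Spinor}
    (hw : ∀ v, IsCoherentSpinor v (w v)) {c : ℝ → Config} {ξm ξp : Fin 5 → R3}
    (hF : ∀ a b, a < b → FaceConditions (c 0).1 a b (D.n a b) (D.n b a))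
    (hn : ∀ a b, a ≠ b → (c 0).2 a b = D.n a b)
    (hm : ∀ a i j, HasDerivAt (fun t => ((c t).1 a).1.1 i j)
      ((((c 0).1 a).1.1 * su2 (ξm a)) i j) 0)
    (hp : ∀ a i j, HasDerivAt (fun t => ((c t).1 a).2.1 i j)
      ((((c 0).1 a).2.1 * su2 (ξp a)) i j) 0)
    (hd : ∀ a b, DifferentiableAt ℝ (fun t => ((c t).2 a b : R3)) 0) :
    HasDerivAt (fun t => expAction D ν w (c t)) (expAction D ν w (c 0) * (-(Complex.I / 2) *
      ((∑ a, inner ℝ ((1 + γ) • ξp a - (γ - 1) • ξm a) (closureVec D a) : ℝ) : ℂ))) 0 := by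
  simp only [expAction_eq]
  -- `h a b` is the part of the face term due to the motion of `G_a`, weighted by `2s⁺ = (1+γ)k` and
  -- `2s⁻ = (γ-1)k`. The face `a < b` carries `h a b + h b a`, so the total regroups into one
  -- closure vector for each `a`.
  set h : Fin 5 → Fin 5 → ℝ := fun a b =>
    (1 + γ) * D.twoK a b / 2 * inner ℝ (ξp a) (D.n a b : R3) -
      (γ - 1) * D.twoK a b / 2 * inner ℝ (ξm a) (D.n a b : R3) with hh
  have hsum : (∑ a, inner ℝ ((1 + γ) • ξp a - (γ - 1) • ξm a) (closureVec D a) : ℝ) =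
      ∑ a : Fin 5, ∑ b ∈ Finset.univ.filter (fun b => a < b), (h a b + h b a) := by
    rw [sum_lt_add_swap]
    refine Finset.sum_congr rfl fun a _ => ?_
    rw [closureVec, inner_sum]
    refine Finset.sum_congr rfl fun b _ => ?_
    rw [inner_smul_right, inner_sub_left, real_inner_smul_left, real_inner_smul_left]
    ring
  have hdist : -(Complex.I / 2) * ((∑ a : Fin 5, ∑ b ∈ Finset.univ.filter (fun b => a < b),
      (h a b + h b a) : ℝ) : ℂ) = ∑ a : Fin 5, ∑ b ∈ Finset.univ.filter (fun b => a < b),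
        -(Complex.I / 2) * ((h a b + h b a : ℝ) : ℂ) := by
    rw [Complex.ofReal_sum]
    simp only [Complex.ofReal_sum, Finset.mul_sum]
  rw [hsum, hdist]
  refine hasDerivAt_log_prod _ fun a _ => hasDerivAt_log_prod _ fun b hb => ?_
  have hab : a < b := (Finset.mem_filter.1 hb).2
  have hFab := hF a b hab
  have hνab := hν a b hab.ne
  have hνba := hν b a hab.ne'
  rw [← hn a b hab.ne, ← hn b a hab.ne'] at hFab
  rw [← hn a b hab.ne] at hνab
  rw [← hn b a hab.ne'] at hνba
  have key := FaceConditions.hasDerivAt_face (D.pos a b hab.ne) (D.twoSPlus_eq_add hγ hab.ne)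
    (G := fun t => (c t).1) (m := fun t => (c t).2 a b) (m' := fun t => (c t).2 b a)
    hFab hw hνab hνba hm hp (hd a b) (hd b a)
  have e : (((h a b + h b a : ℝ)) : ℂ) =
      (twoSPlus γ (D.twoK a b) : ℂ) * ((inner ℝ (ξp a) ((c 0).2 a b : R3) +
        inner ℝ (ξp b) ((c 0).2 b a : R3) : ℝ) : ℂ) -
      (twoSMinus γ (D.twoK a b) : ℂ) * ((inner ℝ (ξm a) ((c 0).2 a b : R3) +
        inner ℝ (ξm b) ((c 0).2 b a : R3) : ℝ) : ℂ) := by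
    rw [← Complex.ofReal_natCast, ← Complex.ofReal_natCast, D.twoSPlus_eq hγ hab.ne,
      D.twoSMinus_eq hγ hab.ne, hn a b hab.ne, hn b a hab.ne', ← Complex.ofReal_mul,
      ← Complex.ofReal_mul, ← Complex.ofReal_sub]
    congr 1
    simp only [hh, D.symm b a]
    ring
  rw [e]
  exact key

/-! ### Closure and the characterisation of critical points -/

theorem one_le_norm_of_one_le_norm_prod {ι : Type*} {s : Finset ι} {f : ι → ℂ}
    (hf : ∀ i ∈ s, ‖f i‖ ≤ 1) (h : 1 ≤ ‖∏ i ∈ s, f i‖) {i : ι} (hi : i ∈ s) : 1 ≤ ‖f i‖ := by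
  classical
  rw [← Finset.mul_prod_erase s f hi, norm_mul] at h
  have h1 : ‖∏ j ∈ s.erase i, f j‖ ≤ 1 := by
    rw [norm_prod]
    exact Finset.prod_le_one (fun _ _ => norm_nonneg _) fun j hj => hf j (Finset.mem_of_mem_erase hj)
  exact h.trans (mul_le_of_le_one_right (norm_nonneg _) h1)

theorem one_le_norm_faceFactor {γ : ℝ} (D : BoundaryData γ) {ν : Fin 5 → Fin 5 → Spinor}
    (hν : ∀ a b, a ≠ b → IsCoherentSpinor (D.n a b) (ν a b)) {w : UnitVec → Spinor}
    (hw : ∀ v, IsCoherentSpinor v (w v)) {x : Config} (h : 1 ≤ ‖expAction D ν w x‖)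
    {a b : Fin 5} (hab : a < b) : 1 ≤ ‖faceFactor D ν w x a b‖ := by
  have hle : ∀ a b : Fin 5, a < b → ‖faceFactor D ν w x a b‖ ≤ 1 := by
    intro a b hab
    rw [faceFactor_eq]
    exact (norm_spinorFace_le (hw _) (hw _) (hν a b hab.ne) (hν b a hab.ne')).1
  have h1 := one_le_norm_of_one_le_norm_prod (fun a _ => by
    rw [norm_prod]
    exact Finset.prod_le_one (fun _ _ => norm_nonneg _)
      fun b hb => hle a b (Finset.mem_filter.1 hb).2) h (Finset.mem_univ a)
  exact one_le_norm_of_one_le_norm_prod (fun b hb => hle a b (Finset.mem_filter.1 hb).2) h1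
    (Finset.mem_filter.2 ⟨Finset.mem_univ b, hab⟩)

/-- The variation of `X⁺_a` along a one-parameter subgroup. -/
def plusVariation (G : Fin 5 → Spin4) (m : Fin 5 → Fin 5 → UnitVec) (a : Fin 5) (i : Fin 3)
    (t : ℝ) : Config :=
  (fun b => ((G b).1, (G b).2 * expTau i ((if b = a then 1 else 0) * t)), m)

theorem plusVariation_zero (G : Fin 5 → Spin4) (m : Fin 5 → Fin 5 → UnitVec) (a : Fin 5)
    (i : Fin 3) : plusVariation G m a i 0 = (G, m) := by
  simp [plusVariation, expTau_zero]

/-- Varying `X⁺_a` alone suffices: the logarithmic derivative is `-(i/2)(1+γ)` times a component of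
the closure vector, and `1 + γ ≠ 0`. -/
theorem closureVec_eq_zero {γ : ℝ} (hγ : 1 < γ) (D : BoundaryData γ) {ν : Fin 5 → Fin 5 → Spinor}
    (hν : ∀ a b, a ≠ b → IsCoherentSpinor (D.n a b) (ν a b)) {w : UnitVec → Spinor}
    (hw : ∀ v, IsCoherentSpinor v (w v)) {G : Fin 5 → Spin4} {m : Fin 5 → Fin 5 → UnitVec}
    (hF : ∀ a b, a < b → FaceConditions G a b (D.n a b) (D.n b a))
    (hn : ∀ a b, a ≠ b → m a b = D.n a b) (hcrit : IsCriticalPoint (expAction D ν w) (G, m))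
    (a : Fin 5) : closureVec D a = 0 := by
  ext i
  have h0 := plusVariation_zero G m a i
  have hp : ∀ b A B, HasDerivAt (fun t => ((plusVariation G m a i t).1 b).2.1 A B)
      ((((plusVariation G m a i 0).1 b).2.1 *
        su2 ((if b = a then (1 : ℝ) else 0) • EuclideanSpace.single i (1 : ℝ))) A B) 0 := by
    intro b A B
    rw [h0]
    exact hasDerivAt_expTau (G b).2 i _ A B
  have hm : ∀ b A B, HasDerivAt (fun t => ((plusVariation G m a i t).1 b).1.1 A B)
      ((((plusVariation G m a i 0).1 b).1.1 * su2 0) A B) 0 := by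
    intro b A B
    have : su2 0 = 0 := by simp [su2]
    rw [this, mul_zero]
    exact hasDerivAt_const (0 : ℝ) ((G b).1.1 A B)
  have hd : ∀ b c, DifferentiableAt ℝ (fun t => ((plusVariation G m a i t).2 b c : R3)) 0 :=
    fun b c => differentiableAt_const (m b c : R3)
  have hder := hasDerivAt_expAction hγ D hν hw (c := plusVariation G m a i)
    (ξm := fun _ => 0) (by rw [h0]; exact hF) (by rw [h0]; exact hn) hm hp hd
  obtain ⟨S, hS, hS'⟩ := hcrit.stationary _ ⟨h0, fun b A B => (hm b A B).differentiableAt,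
    fun b A B => (hp b A B).differentiableAt, hd⟩
  have hder0 := hS'.cexp.congr_of_eventuallyEq (hS.mono fun t ht => ht.symm)
  have hval := hder.unique hder0
  rw [mul_zero, h0] at hval
  obtain ⟨S₀, hS₀, -⟩ := hcrit.re_nonneg
  have hne : expAction D ν w (G, m) ≠ 0 := by rw [← hS₀]; exact Complex.exp_ne_zero _
  have hz : (∑ b, inner ℝ ((1 + γ) • (if b = a then (1 : ℝ) else 0) •
      (EuclideanSpace.single i (1 : ℝ) : R3) - (γ - 1) • 0) (closureVec D b) : ℝ) = 0 := by
    have h1 := (mul_eq_zero.1 hval).resolve_left hne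
    have h2 := (mul_eq_zero.1 h1).resolve_left (by simp)
    exact_mod_cast h2
  rw [Finset.sum_eq_single a (fun b _ hb => by simp [hb]) (by simp)] at hz
  simp only [if_true, one_smul, smul_zero, sub_zero, real_inner_smul_left,
    EuclideanSpace.inner_single_left] at hz
  have h1 := (mul_eq_zero.1 hz).resolve_left (by linarith)
  simpa using h1

theorem expAction_stationary {γ : ℝ} (hγ : 1 < γ) (D : BoundaryData γ)
    {ν : Fin 5 → Fin 5 → Spinor}
    (hν : ∀ a b, a ≠ b → IsCoherentSpinor (D.n a b) (ν a b)) {w : UnitVec → Spinor}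
    (hw : ∀ v, IsCoherentSpinor v (w v)) {x : Config}
    (hF : ∀ a b, a < b → FaceConditions x.1 a b (D.n a b) (D.n b a))
    (hn : ∀ a b, a ≠ b → x.2 a b = D.n a b) (hcl : ∀ a, closureVec D a = 0) {c : ℝ → Config}
    (hc : IsVariation x c) : HasDerivAt (fun t => expAction D ν w (c t)) 0 0 := by
  obtain ⟨hc0, hcm, hcp, hcd⟩ := hc
  choose ξm hξm using fun a => exists_su2_velocity (X := fun t => ((c t).1 a).1) (hcm a)
  choose ξp hξp using fun a => exists_su2_velocity (X := fun t => ((c t).1 a).2) (hcp a)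
  have hder := hasDerivAt_expAction hγ D hν hw (by rw [hc0]; exact hF) (by rw [hc0]; exact hn)
    hξm hξp hcd
  simpa [hcl] using hder

/-- A function with a nonzero value and zero derivative has a local logarithm with zero
derivative. -/
theorem exists_log_hasDerivAt_zero {f : ℝ → ℂ} (h0 : f 0 ≠ 0) (hf : HasDerivAt f 0 0) :
    ∃ S : ℝ → ℂ, (∀ᶠ t in 𝓝 (0 : ℝ), Complex.exp (S t) = f t) ∧ HasDerivAt S 0 0 := by
  -- Dividing by `f 0` moves the base value to 1, away from the branch cut.
  refine ⟨fun t => Complex.log (f t / f 0) + Complex.log (f 0), ?_, ?_⟩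
  · filter_upwards [hf.continuousAt.eventually_ne h0] with t ht
    rw [Complex.exp_add, Complex.exp_log (div_ne_zero ht h0), Complex.exp_log h0,
      div_mul_cancel₀ _ h0]
  · have h1 : HasDerivAt (fun t => f t / f 0) 0 0 := by
      simpa using hf.div_const (f 0)
    have h2 := h1.clog_real (by rw [div_self h0]; exact Complex.one_mem_slitPlane)
    simpa using h2.add_const (Complex.log (f 0))

/-- The critical points of the proper action. -/
theorem isCriticalPoint_expAction_iff {γ : ℝ} (hγ : 1 < γ) (D : BoundaryData γ)
    {ν : Fin 5 → Fin 5 → Spinor} (hν : ∀ a b, a ≠ b → IsCoherentSpinor (D.n a b) (ν a b))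
    {w : UnitVec → Spinor} (hw : ∀ v, IsCoherentSpinor v (w v))
    (G : Fin 5 → Spin4) (m : Fin 5 → Fin 5 → UnitVec) :
    IsCriticalPoint (expAction D ν w) (G, m) ↔
      Closure D ∧ Orientation D G ∧ ProperOrientation D G ∧ ∀ a b, a ≠ b → m a b = D.n a b := by
  constructor
  · intro hcrit
    have h1 : 1 ≤ ‖expAction D ν w (G, m)‖ := by
      obtain ⟨S₀, hS₀, hre⟩ := hcrit.re_nonneg
      rw [← hS₀, Complex.norm_exp]
      exact Real.one_le_exp hre
    have hface : ∀ a b, a < b → m a b = D.n a b ∧ m b a = D.n b a ∧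
        FaceConditions G a b (D.n a b) (D.n b a) := by
      intro a b hab
      have h2 := one_le_norm_faceFactor D hν hw h1 hab
      rw [faceFactor_eq] at h2
      have hq := D.twoSMinus_ne_zero hγ hab.ne
      obtain ⟨e1, e2, e3, e4, e5⟩ := conditions_of_one_le_norm_face (D.pos a b hab.ne).ne'
        (by rw [D.twoSPlus_eq_add hγ hab.ne]; omega) hq (hw _) (hw _) (hν a b hab.ne)
        (hν b a hab.ne') h2
      exact ⟨e1, e2, e3, e4, e5⟩
    have hn : ∀ a b, a ≠ b → m a b = D.n a b := by
      intro a b hab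
      rcases lt_or_gt_of_ne hab with h | h
      · exact (hface a b h).1
      · exact (hface b a h).2.1
    refine ⟨closureVec_eq_zero hγ D hν hw (fun a b h => (hface a b h).2.2) hn hcrit, ?_,
      fun a b h => (hface a b h).2.2.proper, hn⟩
    intro a b hab
    rcases lt_or_gt_of_ne hab with h | h
    · exact ⟨(hface a b h).2.2.minus, (hface a b h).2.2.plus⟩
    · rw [(hface b a h).2.2.minus, (hface b a h).2.2.plus, neg_neg, neg_neg]
      exact ⟨rfl, rfl⟩
  · rintro ⟨hcl, ho, hpo, hn⟩
    have hF : ∀ a b, a < b → FaceConditions G a b (D.n a b) (D.n b a) := fun a b h =>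
      ⟨(ho a b h.ne).1, (ho a b h.ne).2, hpo a b h⟩
    have h1 : ‖expAction D ν w (G, m)‖ = 1 := by
      rw [expAction_eq, norm_prod]
      refine Finset.prod_eq_one fun a _ => ?_
      rw [norm_prod]
      refine Finset.prod_eq_one fun b hb => ?_
      have hab : a < b := (Finset.mem_filter.1 hb).2
      refine (hF a b hab).norm_face (D.pos a b hab.ne) ?_ ?_ (hν a b hab.ne) (hν b a hab.ne')
      · rw [← hn a b hab.ne]
        exact hw _
      · rw [← hn b a hab.ne']
        exact hw _
    have hne : expAction D ν w (G, m) ≠ 0 := by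
      rw [← norm_ne_zero_iff, h1]
      exact one_ne_zero
    refine ⟨⟨Complex.log (expAction D ν w (G, m)), Complex.exp_log hne, ?_⟩, fun c hc => ?_⟩
    · rw [Complex.log_re, h1, Real.log_one]
    · refine exists_log_hasDerivAt_zero (f := fun t => expAction D ν w (c t)) ?_
        (expAction_stationary hγ D hν hw hF hn hcl hc)
      rw [hc.start]
      exact hne

end ProperEPRL

end

theorem mainTheorem4 (γ : ℝ) (hγ : 1 < γ) (D : ProperEPRL.BoundaryData γ)
    (ν : Fin 5 → Fin 5 → ProperEPRL.Spinor)
    (hν : ∀ a b, a ≠ b → ProperEPRL.IsCoherentSpinor (D.n a b) (ν a b))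
    (w : ProperEPRL.UnitVec → ProperEPRL.Spinor)
    (hw : ∀ v, ProperEPRL.IsCoherentSpinor v (w v))
    (G : Fin 5 → ProperEPRL.Spin4) (m : Fin 5 → Fin 5 → ProperEPRL.UnitVec) :
    ProperEPRL.IsCriticalPoint (ProperEPRL.expAction D ν w) (G, m) ↔
      ProperEPRL.Closure D ∧ ProperEPRL.Orientation D G ∧ ProperEPRL.ProperOrientation D G ∧
        ∀ a b, a ≠ b → m a b = D.n a b := by
  exact ProperEPRL.isCriticalPoint_expAction_iff hγ D hν hw G m
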